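/- Let $q\in\mathbb C$, $q\neq 0$, with $q^m\neq 1$ for all integers $m\ge 1$; let $c^2$ be a nonzero real number, let $N\ge 3$ be an integer and $n=\lfloor N/2\rfloor$, so that $N=2n$ or $N=2n+1$. Write $i'=N+1-i$ for $1\le i\le N$, $\rho_i=N/2-i$ if $i<i'$, $\rho_i=-(N/2-i')$ if $i'<i$, $\rho_i=0$ if $i=i'$, and put $$C^{ij}=C_{ij}=q^{-2\rho_i}\delta_{i,j'},\qquad K^{ij}_{kl}=C^{ij}C_{kl},$$ $$\hat R^{ij}_{kl}=q^{2\delta_{ij}-2\delta_{ij'}}\delta_{il}\delta_{jk}+(q^2-q^{-2})\,[i<l]\,(\delta_{ik}\delta_{jl}-K^{ij}_{kl}),$$ $$P_+=\frac1{q^2+q^{-2}}\Bigl(q^{-2}\,\mathrm{id}+\hat R-\frac{(q+q^{-1})(q-q^{-1})}{q^{2N}-1}K\Bigr),$$ where $[i<l]$ is $1$ if $i<l$ and $0$ otherwise. Let $\mathrm{Cl}_N$ be the complex unital algebra generated by $\gamma_1,\dots,\gamma_N$ with the relations $\sum_{k,l}(P_+)^{kl}_{ij}\gamma_k\gamma_l=0$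 for all $i,j$, and $\sum_{i,j}C^{ij}\gamma_i\gamma_j=c^2\frac{q^{2N}-1}{q^2-1}$. Its $\mathbb Z/2$-grading is the one in which all $\gamma_i$ are odd. Let $\mu=(\mu_1,\dots,\mu_n)\in(\mathbb C^\times)^n$; set $\mu_{i'}=\mu_i^{-1}$ for $1\le i\le n$, and $\mu_i=1$ if $i=i'$. Let $\mathcal Z^\mu_N=\{z\in\mathrm{Cl}_N : z\gamma_i=\mu_i\gamma_iz \text{ for all } i=1,\dots,N\}$, and let $\mathcal Z^{\mu,0}_N$ and $\mathcal Z^{\mu,1}_N$ be the subspaces of its even and of its odd elements, respectively. For $\hat\eta\in\{0,1\}$ put $$z_{\mu,\hat\eta}=\sum_{k=0}^n\ \sum_{1\le i_1<i_2<\cdots<i_k\le n}\left(\prod_{r=1}^k\frac{\mu_{i_r}-(-q^2)^{\hat\eta}q^{4k-4r}}{c^2(q+q^{-1})q^{N+1-2i_r}}\right)\gamma_{i_1}\gamma_{i_2}\cdots\gamma_{i_k}\,\gamma_{n+1}^{\hat\eta}\,\gamma_{i_k'}\cdots\gamma_{i_2'}\gamma_{i_1'}.$$ Then $\mathcal Z^{\mu,0}_N$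 is one-dimensional and is spanned by $z_{\mu,0}$, both for $N=2n$ and for $N=2n+1$; and if $N=2n+1$, then $\mathcal Z^{\mu,1}_N$ is one-dimensional and is spanned by $z_{\mu,1}$. -/

import Mathlib

noncomputable section

namespace FRTClifford

/-! Indices run over `Fin N`, so the index `i` of the literature (between `1` and `N`) is
`(i : ℕ) + 1` here, and the involution `i ↦ N + 1 - i` is `Fin.rev`. -/

/-- The integer `2 ρ_i`, where `ρ_i = N/2 - i` if `i < i'`, `ρ_i = -(N/2 - i')` if `i' < i`
and `ρ_i = 0` if `i = i'` (with `i` counted from one). -/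
def twoRho {N : ℕ} (i : Fin N) : ℤ :=
  if i < i.rev then (N : ℤ) - 2 * ((i : ℤ) + 1)
  else if i.rev < i then -((N : ℤ) - 2 * ((i.rev : ℤ) + 1))
  else 0

/-- The quantum metric `C^{ij} = C_{ij} = q^{-2 ρ_i} δ_{i j'}`. -/
def metricC {N : ℕ} (q : ℂ) (i j : Fin N) : ℂ :=
  if i = j.rev then q ^ (-twoRho i) else 0

/-- `K^{ij}_{kl} = C^{ij} C_{kl}`; the row index is `(i, j)`, the column index is `(k, l)`. -/
def matK (N : ℕ) (q : ℂ) : Matrix (Fin N × Fin N) (Fin N × Fin N) ℂ :=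
  fun a b => metricC q a.1 a.2 * metricC q b.1 b.2

/-- The braiding matrix of the orthogonal quantum group:
`R^{ij}_{kl} = q^{2 δ_{ij} - 2 δ_{ij'}} δ_{il} δ_{jk}
  + (q^2 - q^{-2}) [i < l] (δ_{ik} δ_{jl} - K^{ij}_{kl})`. -/
def matR (N : ℕ) (q : ℂ) : Matrix (Fin N × Fin N) (Fin N × Fin N) ℂ :=
  fun a b =>
    (if a.1 = b.2 ∧ a.2 = b.1 then
      q ^ (2 * (if a.1 = a.2 then (1 : ℤ) else 0) - 2 * (if a.1 = a.2.rev then (1 : ℤ) else 0))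
      else 0)
    + (if a.1 < b.2 then
        (q ^ (2 : ℤ) - q ^ (-2 : ℤ)) * ((if a.1 = b.1 ∧ a.2 = b.2 then 1 else 0) - matK N q a b)
      else 0)

/-- The projector `P_+` onto the `q^2`-eigenspace of the braiding matrix. -/
def projPlus (N : ℕ) (q : ℂ) : Matrix (Fin N × Fin N) (Fin N × Fin N) ℂ :=
  (q ^ (2 : ℤ) + q ^ (-2 : ℤ))⁻¹ •
    (q ^ (-2 : ℤ) • (1 : Matrix (Fin N × Fin N) (Fin N × Fin N) ℂ) + matR N q
      - (((q + q⁻¹) * (q - q⁻¹)) / (q ^ (2 * N) - 1)) • matK N q)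

/-- The defining relations of the quantum Clifford algebra with parameter `c2` (standing for
`c^2`): `P_+^{kl}_{ij} γ_k γ_l = 0` for all `i, j`, and
`C^{ij} γ_i γ_j = c^2 (q^{2N} - 1) / (q^2 - 1)`. -/
inductive Rel (N : ℕ) (q c2 : ℂ) : FreeAlgebra ℂ (Fin N) → FreeAlgebra ℂ (Fin N) → Prop
  | proj (i j : Fin N) :
      Rel N q c2
        (∑ k : Fin N, ∑ l : Fin N,
          projPlus N q (k, l) (i, j) • (FreeAlgebra.ι ℂ k * FreeAlgebra.ι ℂ l))
        0
  | metric :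
      Rel N q c2
        (∑ i : Fin N, ∑ j : Fin N, metricC q i j • (FreeAlgebra.ι ℂ i * FreeAlgebra.ι ℂ j))
        (algebraMap ℂ (FreeAlgebra ℂ (Fin N)) (c2 * ((q ^ (2 * N) - 1) / (q ^ 2 - 1))))

/-- The quantum Clifford algebra. -/
abbrev Cl (N : ℕ) (q c2 : ℂ) : Type := RingQuot (Rel N q c2)

/-- The generators `γ_i`. -/
def gen (N : ℕ) (q c2 : ℂ) (i : Fin N) : Cl N q c2 :=
  RingQuot.mkAlgHom ℂ (Rel N q c2) (FreeAlgebra.ι ℂ i)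

/-- The component of degree `η` of the algebra for the `ℤ/2`-grading in which all generators
are odd: the span of the words in the generators whose length has parity `η`. -/
def parity (N : ℕ) (q c2 : ℂ) (η : Fin 2) : Submodule ℂ (Cl N q c2) :=
  Submodule.span ℂ
    {x | ∃ w : List (Fin N), w.length % 2 = (η : ℕ) ∧ x = (w.map (gen N q c2)).prod}

/-- The extension of `μ_1, …, μ_n`, with `n = ⌊N/2⌋`, to all indices:
`μ_{i'} = μ_i⁻¹` for `i < i'`, and `μ_i = 1` for `i = i'`. -/
def muExt {N : ℕ} (μ : Fin (N / 2) → ℂˣ) (i : Fin N) : ℂˣ :=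
  if h : i < i.rev then
    μ ⟨i, by have h1 : (i : ℕ) < (i.rev : ℕ) := h; rw [Fin.val_rev] at h1; omega⟩
  else if h : i.rev < i then
    (μ ⟨i.rev, by have h1 : (i.rev : ℕ) < (i : ℕ) := h; rw [Fin.val_rev] at h1 ⊢; omega⟩)⁻¹
  else 1

/-- The space of all `z` with `z γ_i = μ_i γ_i z` for all `i = 1, …, N`. -/
def centerMu (N : ℕ) (q c2 : ℂ) (μ : Fin (N / 2) → ℂˣ) : Submodule ℂ (Cl N q c2) where
  carrier := {z | ∀ i : Fin N,
    z * gen N q c2 i = (muExt μ i : ℂ) • (gen N q c2 i * z)}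
  add_mem' := by
    intro a b ha hb i
    rw [add_mul, mul_add, smul_add, ha i, hb i]
  zero_mem' := by
    intro i
    rw [zero_mul, mul_zero, smul_zero]
  smul_mem' := by
    intro r a ha i
    rw [smul_mul_assoc, ha i, mul_smul_comm, smul_comm]

/-- The homogeneous component of parity `η` of `centerMu`. -/
def centerMuParity (N : ℕ) (q c2 : ℂ) (μ : Fin (N / 2) → ℂˣ) (η : Fin 2) :
    Submodule ℂ (Cl N q c2) :=
  centerMu N q c2 μ ⊓ parity N q c2 η

/-- An index `i ≤ n = ⌊N/2⌋` as an index `i ≤ N`. -/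
def low {N : ℕ} (i : Fin (N / 2)) : Fin N := Fin.castLE (Nat.div_le_self N 2) i

/-- The `r`-th smallest element of `s` (counted from zero). -/
def nth {m : ℕ} (s : Finset (Fin m)) (r : Fin s.card) : Fin m := s.orderEmbOfFin rfl r

/-- The summand of `z_{μ,η}` belonging to the subset `s = {i_1 < … < i_k}` of `{1, …, n}`,
`n = ⌊N/2⌋`. -/
def zTerm (N : ℕ) (hN : 3 ≤ N) (q c2 : ℂ) (μ : Fin (N / 2) → ℂˣ) (η : Fin 2)
    (s : Finset (Fin (N / 2))) : Cl N q c2 :=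
  (∏ r : Fin s.card,
    ((μ (nth s r) : ℂ) - (-q ^ 2) ^ (η : ℕ) * q ^ (4 * (s.card : ℤ) - 4 * ((r : ℤ) + 1))) /
      (c2 * (q + q⁻¹) * q ^ ((N : ℤ) + 1 - 2 * ((nth s r : ℤ) + 1)))) •
    ((List.ofFn fun r => gen N q c2 (low (nth s r))).prod
      * gen N q c2 ⟨N / 2, by omega⟩ ^ (η : ℕ)
      * (List.ofFn fun r => gen N q c2 (low (nth s r)).rev).reverse.prod)

/-- The element `z_{μ,η}`: the sum over all `k` and all `1 ≤ i_1 < … < i_k ≤ n`. -/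
def zElem (N : ℕ) (hN : 3 ≤ N) (q c2 : ℂ) (μ : Fin (N / 2) → ℂˣ) (η : Fin 2) : Cl N q c2 :=
  ∑ s : Finset (Fin (N / 2)), zTerm N hN q c2 μ η s

end FRTClifford

end

noncomputable section

namespace FRTClifford

open Finset

/-! Put `x i` = γ_i, `y i` = γ_{i'}, `t` = γ_{n+1} (zero for even `N`) and `p = q ^ 2`. The Clifford
relations then say that generators from different pairs commute up to the factor `-p`, and that `x j
* y j + y j * x j` is a constant `κ j` times one plus a correction built from the `x k * y k` with
`k < j`. On a vector killed by all `y k` with `k < j` the correction vanishes and the pair `j` is an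
ordinary fermion (`anticomm_apply`).

Existence. Let Z_j be the part of z_{μ,η} indexed by subsets of {j, …, n-1}. Moving `x j` through a
summand of Z_{j+1} costs exactly the scalar subtracted from μ_j in the coefficients. Hence, on
vectors killed by the `y k` with `k < j`, Z_j = κ_j⁻¹ (Z_{j+1} y_j x_j + μ_j x_j Z_{j+1} y_j)
(`nestedSum_mul`). The twisted commutation follows by descending induction on `j`
(`nestedSum_mul_comm`); at `j = 0` no condition on the vector is left, so it holds in the algebra.

Uniqueness. Let v be the product of all `y k`. If z satisfies the twisted commutation, then z v is
again killed by every `y k`. It lies in the Fock module generated by v, whose only such vectors of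
parity η are multiples of t^η v (`mem_fock_zero`), and z_{μ,η} v = t^η v. So some z - c z_{μ,η}
kills v. Since z A ⊆ A z for such elements, it kills the left ideal of v, and it vanishes because
the two-sided ideal of v is everything (`eq_zero_of_mul_vacuum`).

The algebra must also be nonzero, so that z_{μ,η} ≠ 0: a Jordan–Wigner type representation on
functions of finite sets shows this (`isFermiSystem_creation`, `nontrivial_Cl`). -/

/-! ### Deformed fermions: relations, nested sums, vacuum, Fock module -/

/-- Relations of a system of `n` pairs of `q`-deformed fermions `x i`, `y i` together with a
further generator `t`, which is normalised by `τ`. -/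
structure IsFermiSystem {B : Type*} [Ring B] [Algebra ℂ B] (p τ : ℂ) (κ : ℕ → ℂ) (n : ℕ)
    (x y : ℕ → B) (t : B) : Prop where
  x_sq : ∀ i < n, x i * x i = 0
  y_sq : ∀ i < n, y i * y i = 0
  x_mul_x : ∀ i j, i < j → j < n → x j * x i = (-p) • (x i * x j)
  y_mul_y : ∀ i j, i < j → j < n → y i * y j = (-p) • (y j * y i)
  y_mul_x : ∀ i j, i < n → j < n → i ≠ j → y i * x j = (-p) • (x j * y i)
  t_mul_x : ∀ i < n, t * x i = (-p) • (x i * t)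
  y_mul_t : ∀ i < n, y i * t = (-p) • (t * y i)
  anticomm : ∀ j < n, x j * y j + y j * x j
    = κ j • (1 + (p ^ 2 - 1) • ∑ k ∈ range j, (κ k)⁻¹ • (x k * y k))
  t_sq : t * t = τ • (1 + (p ^ 2 - 1) • ∑ k ∈ range n, (κ k)⁻¹ • (x k * y k))

/-- The summand of the deformed central element belonging to an increasing list. -/
def nestedTerm {B : Type*} [Ring B] [Algebra ℂ B] (p θ : ℂ) (κ μ : ℕ → ℂ) (x y : ℕ → B)
    (t : B) : List ℕ → B
  | [] => t
  | i :: l => ((μ i - θ * p ^ (2 * l.length)) / κ i) • (x i * nestedTerm p θ κ μ x y t l * y i)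

/-- The sum of the nested terms over all subsets of `{j, …, n - 1}`. -/
def nestedSum {B : Type*} [Ring B] [Algebra ℂ B] (p θ : ℂ) (κ μ : ℕ → ℂ) (n : ℕ) (x y : ℕ → B)
    (t : B) (j : ℕ) : B :=
  ∑ s ∈ (Ico j n).powerset, nestedTerm p θ κ μ x y t (s.sort (· ≤ ·))

/-- The product `y (m - 1) * ⋯ * y 0`. -/
def vacuum {B : Type*} [Ring B] (y : ℕ → B) : ℕ → B
  | 0 => 1
  | m + 1 => y m * vacuum y m

/-- The homogeneous part of parity `e` of the module generated from `t ^ e * v` by the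
creation operators `x (n - d), …, x (n - 1)`. -/
def fock {B : Type*} [Ring B] [Algebra ℂ B] (n : ℕ) (x : ℕ → B) (t v : B) :
    ℕ → ℕ → Submodule ℂ B
  | 0, e => Submodule.span ℂ {t ^ (e % 2) * v}
  | d + 1, e => fock n x t v d e ⊔
      (fock n x t v d (e + 1)).map (LinearMap.mulLeft ℂ (x (n - 1 - d)))

/-! ### The vacuum and its Fock module -/

section

variable {B : Type*} [Ring B] [Algebra ℂ B] {p τ : ℂ} {κ : ℕ → ℂ} {n : ℕ} {x y : ℕ → B} {t : B}

namespace IsFermiSystem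

/-- Every correction term ends in some `y k` with `k < j`, so it dies on `v`. This is why the later
inductions run over vectors killed by the lower annihilators. -/
lemma anticomm_apply (h : IsFermiSystem p τ κ n x y t) {j : ℕ} (hj : j < n) {v : B}
    (hv : ∀ k < j, y k * v = 0) : x j * (y j * v) + y j * (x j * v) = κ j • v := by
  have h1 := congrArg (· * v) (h.anticomm j hj)
  simp only [add_mul, smul_mul_assoc, Finset.sum_mul, one_mul] at h1
  rw [← mul_assoc, ← mul_assoc, h1, Finset.sum_eq_zero, smul_zero, add_zero]
  intro k hk
  rw [mul_assoc, hv k (mem_range.mp hk), mul_zero, smul_zero]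

lemma t_sq_apply (h : IsFermiSystem p τ κ n x y t) {v : B}
    (hv : ∀ k < n, y k * v = 0) : t * (t * v) = τ • v := by
  have h1 := congrArg (· * v) h.t_sq
  simp only [add_mul, smul_mul_assoc, Finset.sum_mul, one_mul] at h1
  rw [← mul_assoc, h1, Finset.sum_eq_zero, smul_zero, add_zero]
  intro k hk
  rw [mul_assoc, hv k (mem_range.mp hk), mul_zero, smul_zero]

lemma y_mul_vacuum (h : IsFermiSystem p τ κ n x y t) {m : ℕ} (hm : m ≤ n) :
    ∀ k < m, y k * vacuum y m = 0 := by
  induction m with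
  | zero => intro k hk; omega
  | succ m ih =>
    intro k hk
    rw [vacuum, ← mul_assoc]
    rcases Nat.lt_succ_iff_lt_or_eq.mp hk with hk' | rfl
    · rw [h.y_mul_y k m hk' (by omega), smul_mul_assoc, mul_assoc, ih (by omega) k hk', mul_zero,
        smul_zero]
    · rw [h.y_sq k (by omega), zero_mul]

lemma x_mul_vacuum (h : IsFermiSystem p τ κ n x y t) (hp : p ≠ 0) {m j : ℕ} (hm : m ≤ j)
    (hj : j < n) : ∃ c : ℂ, x j * vacuum y m = c • (vacuum y m * x j) := by
  induction m with
  | zero => exact ⟨1, by simp [vacuum]⟩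
  | succ m ih =>
    obtain ⟨c, hc⟩ := ih (by omega)
    refine ⟨(-p)⁻¹ * c, ?_⟩
    have h1 : x j * y m = (-p)⁻¹ • (y m * x j) := by
      rw [h.y_mul_x m j (by omega) hj (by omega), smul_smul, inv_mul_cancel₀ (neg_ne_zero.mpr hp),
        one_smul]
    rw [vacuum, ← mul_assoc, h1, smul_mul_assoc, mul_assoc, hc, mul_smul_comm, smul_smul, mul_assoc]

/-- The two-sided ideal generated by the vacuum is everything. -/
lemma eq_zero_of_mul_vacuum (h : IsFermiSystem p τ κ n x y t) (hp : p ≠ 0)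
    (hκ : ∀ j < n, κ j ≠ 0) {z : B} (hz : ∀ a, z * (a * vacuum y n) = 0) : z = 0 := by
  have key : ∀ d ≤ n, ∀ a, z * (a * vacuum y (n - d)) = 0 := by
    intro d
    induction d with
    | zero => intro _; simpa using hz
    | succ d ih =>
      intro hd a
      obtain ⟨j, hj⟩ : ∃ j, n - (d + 1) = j := ⟨_, rfl⟩
      have hj' : n - d = j + 1 := by omega
      have ih' := ih (by omega)
      rw [hj'] at ih'
      rw [hj]
      have hjn : j < n := by omega
      have h1 := h.anticomm_apply hjn (h.y_mul_vacuum (m := j) (by omega))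
      obtain ⟨c, hc⟩ := h.x_mul_vacuum hp le_rfl hjn
      -- The anticommutator recovers the shorter product from the longer one, which stands once on
      -- the right end and once on the left of `x j`. Only a two-sided argument can use both terms.
      have h2 : vacuum y j = (κ j)⁻¹ • (x j * vacuum y (j + 1) + c • (vacuum y (j + 1) * x j)) := by
        rw [vacuum, mul_assoc, ← mul_smul_comm, ← hc, h1, smul_smul, inv_mul_cancel₀ (hκ j hjn),
          one_smul]
      have e1 := ih' (a * x j)
      have e2 := congrArg (· * x j) (ih' a)
      simp only [zero_mul] at e2
      rw [h2, mul_smul_comm, mul_smul_comm, mul_add, mul_add, ← mul_assoc a, e1, mul_smul_comm,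
        mul_smul_comm, ← mul_assoc a, ← mul_assoc, e2]
      simp
  have := key n le_rfl 1
  simpa [vacuum] using this

lemma vacuum_ne_zero [Nontrivial B] (h : IsFermiSystem p τ κ n x y t) (hp : p ≠ 0)
    (hκ : ∀ j < n, κ j ≠ 0) : vacuum y n ≠ 0 := fun h0 =>
  one_ne_zero (h.eq_zero_of_mul_vacuum hp hκ (z := (1 : B)) fun a => by rw [h0]; simp)

end IsFermiSystem

lemma fock_add_two (v : B) (d e : ℕ) : fock n x t v d (e + 2) = fock n x t v d e := by
  induction d generalizing e with
  | zero => simp [fock]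
  | succ d ih => rw [fock, fock, ih, show e + 2 + 1 = e + 1 + 2 by ring, ih]

lemma fock_mod_two (v : B) (d e : ℕ) : fock n x t v d (e % 2) = fock n x t v d e := by
  induction e using Nat.strong_induction_on with
  | _ e ih =>
    by_cases he : e < 2
    · rw [Nat.mod_eq_of_lt he]
    · obtain ⟨f, rfl⟩ : ∃ f, e = f + 2 := ⟨e - 2, by omega⟩
      rw [Nat.add_mod_right, ih f (by omega), fock_add_two]

lemma exists_of_mem_fock_succ {v : B} {d e : ℕ} {w : B} (hw : w ∈ fock n x t v (d + 1) e) :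
    ∃ a ∈ fock n x t v d e, ∃ b ∈ fock n x t v d (e + 1), a + x (n - 1 - d) * b = w := by
  rw [fock] at hw
  obtain ⟨a, ha, b', hb', rfl⟩ := Submodule.mem_sup.mp hw
  obtain ⟨b, hb, rfl⟩ := Submodule.mem_map.mp hb'
  exact ⟨a, ha, b, hb, rfl⟩

lemma fock_succ_add_mem {v a b : B} {d e : ℕ} (ha : a ∈ fock n x t v d e)
    (hb : b ∈ fock n x t v d (e + 1)) : a + x (n - 1 - d) * b ∈ fock n x t v (d + 1) e :=
  Submodule.add_mem_sup ha (Submodule.mem_map.mpr ⟨b, hb, rfl⟩)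

namespace IsFermiSystem

/-- The first `d` layers use only creators of index at least `n - d`; a lower annihilator moves past
these and past `t` up to scalars and reaches `v`. -/
lemma y_mul_fock (h : IsFermiSystem p τ κ n x y t) {v : B} (hv : ∀ k < n, y k * v = 0)
    {d : ℕ} (hd : d ≤ n) {e : ℕ} {w : B} (hw : w ∈ fock n x t v d e) {k : ℕ} (hk : k < n - d) :
    y k * w = 0 := by
  induction d generalizing e w with
  | zero =>
    obtain ⟨c, rfl⟩ := Submodule.mem_span_singleton.mp hw
    have h1 : y k * (t ^ (e % 2) * v) = 0 := by
      rcases Nat.mod_two_eq_zero_or_one e with he | he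
      · rw [he, pow_zero, one_mul, hv k (by omega)]
      · rw [he, pow_one, ← mul_assoc, h.y_mul_t k (by omega), smul_mul_assoc, mul_assoc,
          hv k (by omega), mul_zero, smul_zero]
    rw [mul_smul_comm, h1, smul_zero]
  | succ d ih =>
    obtain ⟨a, ha, b, hb, rfl⟩ := exists_of_mem_fock_succ hw
    rw [mul_add, ih (by omega) ha (by omega), ← mul_assoc, h.y_mul_x k _ (by omega) (by omega)
      (by omega), smul_mul_assoc, mul_assoc, ih (by omega) hb (by omega)]
    simp

lemma t_mul_fock (h : IsFermiSystem p τ κ n x y t) {v : B} (hv : ∀ k < n, y k * v = 0)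
    {d : ℕ} (hd : d ≤ n) {e : ℕ} {w : B} (hw : w ∈ fock n x t v d e) :
    t * w ∈ fock n x t v d (e + 1) := by
  induction d generalizing e w with
  | zero =>
    obtain ⟨c, rfl⟩ := Submodule.mem_span_singleton.mp hw
    rw [mul_smul_comm]
    refine Submodule.smul_mem _ _ ?_
    rcases Nat.mod_two_eq_zero_or_one e with he | he
    · have he' : (e + 1) % 2 = 1 := by omega
      simp only [fock, he, he', pow_zero, one_mul, pow_one]
      exact Submodule.mem_span_singleton_self _
    · have he' : (e + 1) % 2 = 0 := by omega
      simp only [fock, he, he', pow_zero, one_mul, pow_one]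
      rw [h.t_sq_apply hv]
      exact Submodule.smul_mem _ _ (Submodule.mem_span_singleton_self _)
  | succ d ih =>
    obtain ⟨a, ha, b, hb, rfl⟩ := exists_of_mem_fock_succ hw
    rw [mul_add, ← mul_assoc, h.t_mul_x _ (by omega), smul_mul_assoc, mul_assoc, ← mul_smul_comm]
    exact fock_succ_add_mem (ih (by omega) ha) (Submodule.smul_mem _ _ (ih (by omega) hb))

/-- Creators are added in decreasing order of index, so when `y k` meets its partner `x k`, the
vector behind it is killed by all lower annihilators and the undeformed anticommutator applies. -/
lemma y_mul_mem_fock (h : IsFermiSystem p τ κ n x y t) {v : B}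
    (hv : ∀ k < n, y k * v = 0)
    {d : ℕ} (hd : d ≤ n) {e : ℕ} {w : B} (hw : w ∈ fock n x t v d e) {k : ℕ} (hk : k < n) :
    y k * w ∈ fock n x t v d (e + 1) := by
  induction d generalizing e w with
  | zero => rw [h.y_mul_fock hv hd hw (by omega)]; exact zero_mem _
  | succ d ih =>
    by_cases hkd : k < n - 1 - d
    · rw [h.y_mul_fock hv hd hw (by omega)]; exact zero_mem _
    obtain ⟨a, ha, b, hb, rfl⟩ := exists_of_mem_fock_succ hw
    rcases eq_or_ne k (n - 1 - d) with rfl | hne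
    · have h1 := h.anticomm_apply hk (v := b) fun k hk' =>
        h.y_mul_fock hv (by omega) hb (by omega)
      rw [h.y_mul_fock hv (by omega) hb (by omega), mul_zero, zero_add] at h1
      rw [mul_add, h.y_mul_fock hv (by omega) ha (by omega), zero_add, h1]
      have := fock_succ_add_mem (x := x) (n := n) (t := t) (v := v) (d := d) (e := e + 1)
        (Submodule.smul_mem _ (κ (n - 1 - d)) hb) (zero_mem _)
      simpa using this
    · rw [mul_add, ← mul_assoc, h.y_mul_x _ _ hk (by omega) hne, smul_mul_assoc, mul_assoc,
        ← mul_smul_comm]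
      exact fock_succ_add_mem (ih (by omega) ha) (Submodule.smul_mem _ _ (ih (by omega) hb))

lemma x_mul_mem_fock (h : IsFermiSystem p τ κ n x y t) {v : B}
    {d : ℕ} (hd : d ≤ n) {e : ℕ} {w : B} (hw : w ∈ fock n x t v d e) {k : ℕ} (hk : k < n)
    (hkd : n - d ≤ k) :
    x k * w ∈ fock n x t v d (e + 1) := by
  induction d generalizing e w with
  | zero => omega
  | succ d ih =>
    obtain ⟨a, ha, b, hb, rfl⟩ := exists_of_mem_fock_succ hw
    rcases eq_or_ne k (n - 1 - d) with rfl | hne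
    · rw [mul_add, ← mul_assoc, h.x_sq _ hk, zero_mul, add_zero]
      have := fock_succ_add_mem (x := x) (n := n) (t := t) (v := v) (d := d) (e := e + 1)
        (zero_mem _) (by rw [fock_add_two]; exact ha)
      simpa using this
    · rw [mul_add, ← mul_assoc, h.x_mul_x (n - 1 - d) k (by omega) hk, smul_mul_assoc, mul_assoc,
        ← mul_smul_comm]
      exact fock_succ_add_mem (ih (by omega) ha (by omega))
        (Submodule.smul_mem _ _ (ih (by omega) hb (by omega)))

/-- A vector of the Fock space killed by all annihilation operators is a vacuum vector. -/
lemma mem_fock_zero (h : IsFermiSystem p τ κ n x y t) (hκ : ∀ j < n, κ j ≠ 0) {v : B}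
    (hv : ∀ k < n, y k * v = 0) {d : ℕ} (hd : d ≤ n) {e : ℕ} {w : B}
    (hw : w ∈ fock n x t v d e) (hw' : ∀ k < n, y k * w = 0) : w ∈ fock n x t v 0 e := by
  induction d generalizing e w with
  | zero => exact hw
  | succ d ih =>
    obtain ⟨a, ha, b, hb, rfl⟩ := exists_of_mem_fock_succ hw
    -- With `j = n - 1 - d`, `y j` kills both `a` and `b`, so applying it to `a + x j * b` leaves `κ
    -- j • b`. Hence `b = 0`, and the outermost layer is empty.
    have h1 := h.anticomm_apply (j := n - 1 - d) (by omega) (v := b) fun k hk' =>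
        h.y_mul_fock hv (by omega) hb (by omega)
    have h2 := hw' (n - 1 - d) (by omega)
    rw [mul_add, h.y_mul_fock hv (by omega) ha (by omega), zero_add] at h2
    rw [h2, h.y_mul_fock hv (by omega) hb (by omega), mul_zero, add_zero] at h1
    have h3 : b = 0 := (smul_eq_zero.mp h1.symm).resolve_left (hκ _ (by omega))
    subst h3
    rw [mul_zero, add_zero] at hw' ⊢
    exact ih (by omega) ha hw'

end IsFermiSystem

end

/-! ### Twisted commutation of the nested sums -/

section

variable {B : Type*} [Ring B] [Algebra ℂ B] {p τ θ : ℂ} {κ μ : ℕ → ℂ} {n : ℕ} {x y : ℕ → B}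
  {t w : B}

namespace IsFermiSystem

/-- Each pair `x i`, `y i` around the core contributes `(-p) ^ 2`, and the core `w` contributes `θ`.
-/
lemma nestedTerm_mul_x (h : IsFermiSystem p τ κ n x y t) (hw : ∀ i < n, w * x i = θ • (x i * w))
    {j : ℕ} {l : List ℕ} (hl : ∀ i ∈ l, j < i ∧ i < n) (hj : j < n) :
    nestedTerm p θ κ μ x y w l * x j
      = (θ * p ^ (2 * l.length)) • (x j * nestedTerm p θ κ μ x y w l) := by
  induction l with
  | nil => simp [nestedTerm, hw j hj]
  | cons i l ih =>
    obtain ⟨⟨h1, h2⟩, h3⟩ := List.forall_mem_cons.mp hl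
    have e : x i * nestedTerm p θ κ μ x y w l * y i * x j
        = (θ * p ^ (2 * (l.length + 1))) • (x j * (x i * nestedTerm p θ κ μ x y w l * y i)) := by
      rw [mul_assoc, h.y_mul_x i j h2 hj (by omega), mul_smul_comm, ← mul_assoc,
        mul_assoc (x i), ih h3, mul_smul_comm, ← mul_assoc, h.x_mul_x j i h1 h2]
      simp only [smul_mul_assoc, smul_smul, mul_assoc]
      congr 1
      ring
    rw [nestedTerm, smul_mul_assoc, e, mul_smul_comm, smul_comm, List.length_cons]

lemma y_mul_nestedTerm (h : IsFermiSystem p τ κ n x y t)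
    (hw : ∀ i < n, y i * w = θ • (w * y i))
    {j : ℕ} {l : List ℕ} (hl : ∀ i ∈ l, j < i ∧ i < n) (hj : j < n) :
    y j * nestedTerm p θ κ μ x y w l
      = (θ * p ^ (2 * l.length)) • (nestedTerm p θ κ μ x y w l * y j) := by
  induction l with
  | nil => simp [nestedTerm, hw j hj]
  | cons i l ih =>
    obtain ⟨⟨h1, h2⟩, h3⟩ := List.forall_mem_cons.mp hl
    have e : y j * (x i * nestedTerm p θ κ μ x y w l * y i)
        = (θ * p ^ (2 * (l.length + 1))) • (x i * nestedTerm p θ κ μ x y w l * y i * y j) := by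
      rw [← mul_assoc, ← mul_assoc, h.y_mul_x j i hj h2 (by omega), smul_mul_assoc, mul_assoc (x i),
        ih h3]
      simp only [smul_mul_assoc, mul_smul_comm, mul_assoc, h.y_mul_y j i h1 h2, smul_smul]
      congr 1
      ring
    rw [nestedTerm, smul_mul_assoc, mul_smul_comm, e, smul_comm, List.length_cons]

end IsFermiSystem

lemma mem_sort_powerset_Ico {j : ℕ} {s : Finset ℕ} (hs : s ∈ (Ico (j + 1) n).powerset) :
    ∀ i ∈ s.sort (· ≤ ·), j < i ∧ i < n := by
  intro i hi
  have := mem_Ico.mp (mem_powerset.mp hs ((Finset.mem_sort _).mp hi))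
  omega

lemma nestedSum_self : nestedSum p θ κ μ n x y w n = w := by
  simp [nestedSum, nestedTerm]

namespace IsFermiSystem

/-- Split the subsets by whether they contain `j`. In the terms that do, the scalar subtracted from
`μ j` is the one produced by moving `x j` to the right of the inner term, so it no longer depends on
the size of the subset. -/
lemma nestedSum_succ (h : IsFermiSystem p τ κ n x y t)
    (hw : ∀ i < n, w * x i = θ • (x i * w)) {j : ℕ} (hj : j < n) :
    nestedSum p θ κ μ n x y w j = nestedSum p θ κ μ n x y w (j + 1)
      + (κ j)⁻¹ • (μ j • (x j * nestedSum p θ κ μ n x y w (j + 1) * y j)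
        - nestedSum p θ κ μ n x y w (j + 1) * x j * y j) := by
  have hI : Ico j n = insert j (Ico (j + 1) n) := by ext; simp; omega
  conv_lhs => rw [nestedSum, hI, sum_powerset_insert (by simp)]
  congr 1
  simp only [nestedSum, mul_sum, sum_mul, smul_sum, ← sum_sub_distrib]
  refine sum_congr rfl fun s hs => ?_
  have hl := mem_sort_powerset_Ico hs
  rw [Finset.sort_insert _ (fun b hb => (hl b ((Finset.mem_sort _).mpr hb)).1.le)
    (fun hb => lt_irrefl _ (hl j ((Finset.mem_sort _).mpr hb)).1), nestedTerm,
    h.nestedTerm_mul_x hw hl hj, smul_mul_assoc, ← sub_smul, smul_smul, div_eq_inv_mul]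

lemma y_mul_nestedSum_mul_y (h : IsFermiSystem p τ κ n x y t)
    (hw : ∀ i < n, y i * w = θ • (w * y i)) {j : ℕ} (hj : j < n) :
    y j * nestedSum p θ κ μ n x y w (j + 1) * y j = 0 := by
  simp only [nestedSum, mul_sum, sum_mul]
  refine sum_eq_zero fun s hs => ?_
  rw [h.y_mul_nestedTerm hw (mem_sort_powerset_Ico hs) hj, smul_mul_assoc, mul_assoc, h.y_sq j hj,
    mul_zero, smul_zero]

/-- For each inner term T, `x j` and `y j` move through T with the same scalar c: c y_j x_j T = y_j
T x_j = c T y_j x_j. Cancelling c is where `p` and `θ` must be nonzero. -/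
lemma y_mul_x_mul_nestedSum (h : IsFermiSystem p τ κ n x y t)
    (hw : ∀ i < n, w * x i = θ • (x i * w)) (hw' : ∀ i < n, y i * w = θ • (w * y i))
    (hp : p ≠ 0) (hθ : θ ≠ 0)
    {j : ℕ} (hj : j < n) :
    y j * x j * nestedSum p θ κ μ n x y w (j + 1)
      = nestedSum p θ κ μ n x y w (j + 1) * (y j * x j) := by
  simp only [nestedSum, mul_sum, sum_mul]
  refine sum_congr rfl fun s hs => ?_
  have hl := mem_sort_powerset_Ico hs
  have hc : θ * p ^ (2 * (s.sort (· ≤ ·)).length) ≠ 0 := by positivity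
  have e1 := h.nestedTerm_mul_x (μ := μ) hw hl hj
  have e2 := h.y_mul_nestedTerm (μ := μ) hw' hl hj
  refine smul_right_injective B hc ?_
  dsimp only
  rw [mul_assoc, ← mul_smul_comm, ← e1, ← mul_assoc, e2, smul_mul_assoc, mul_assoc]

/-- On `v` the undeformed anticommutator turns `κ j - x j * y j` into `y j * x j`, so Z_{j+1} is
weighted by 1 when site `j` is empty and conjugated with weight `μ j` when it is occupied. -/
lemma nestedSum_mul (h : IsFermiSystem p τ κ n x y t)
    (hw : ∀ i < n, w * x i = θ • (x i * w)) (hκ : ∀ j < n, κ j ≠ 0) {j : ℕ} (hj : j < n) {v : B}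
    (hv : ∀ k < j, y k * v = 0) :
    nestedSum p θ κ μ n x y w j * v = (κ j)⁻¹ • (nestedSum p θ κ μ n x y w (j + 1)
      * (y j * (x j * v)) + μ j • (x j * (nestedSum p θ κ μ n x y w (j + 1) * (y j * v)))) := by
  have h1 : y j * (x j * v) = κ j • v - x j * (y j * v) := by
    rw [← h.anticomm_apply hj hv]; abel
  rw [h.nestedSum_succ hw hj, h1]
  simp only [mul_sub, mul_smul_comm, smul_add, smul_sub, inv_smul_smul₀ (hκ j hj), add_mul,
    smul_mul_assoc, sub_mul, mul_assoc]
  abel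

/-- Here `g` stands for `t` or for any `x i`, `y i` with `i > j`. Such `g` commutes with `y j * x
j`, and in `x j * Z * y j` the two factors `-p` cancel; the inductive hypothesis applies because `y
j * v` and `y j * (x j * v)` are killed by one more annihilator. -/
lemma nestedSum_mul_comm_step (h : IsFermiSystem p τ κ n x y t)
    (hw : ∀ i < n, w * x i = θ • (x i * w)) (hp : p ≠ 0) (hκ : ∀ j < n, κ j ≠ 0) {j : ℕ}
    (hj : j < n) {g : B} {m : ℂ} (hgx : g * x j = (-p) • (x j * g))
    (hyg : ∀ k ≤ j, y k * g = (-p) • (g * y k))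
    (hg : ∀ v, (∀ k < j + 1, y k * v = 0) → nestedSum p θ κ μ n x y w (j + 1) * (g * v)
      = m • (g * (nestedSum p θ κ μ n x y w (j + 1) * v)))
    {v : B} (hv : ∀ k < j, y k * v = 0) :
    nestedSum p θ κ μ n x y w j * (g * v) = m • (g * (nestedSum p θ κ μ n x y w j * v)) := by
  have hgv : ∀ k < j, y k * (g * v) = 0 := fun k hk => by
    rw [← mul_assoc, hyg k hk.le, smul_mul_assoc, mul_assoc, hv k hk, mul_zero, smul_zero]
  have h1 : ∀ k < j + 1, y k * (y j * v) = 0 := fun k hk => by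
    rw [← mul_assoc]
    rcases Nat.lt_succ_iff_lt_or_eq.mp hk with hk' | rfl
    · rw [h.y_mul_y k j hk' hj, smul_mul_assoc, mul_assoc, hv k hk', mul_zero, smul_zero]
    · rw [h.y_sq k hj, zero_mul]
  have h2 : ∀ k < j + 1, y k * (y j * (x j * v)) = 0 := fun k hk => by
    rw [← mul_assoc]
    rcases Nat.lt_succ_iff_lt_or_eq.mp hk with hk' | rfl
    · rw [h.y_mul_y k j hk' hj, smul_mul_assoc, mul_assoc, ← mul_assoc (y k),
        h.y_mul_x k j (by omega) hj (by omega), smul_mul_assoc, mul_assoc (x j), hv k hk']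
      simp
    · rw [h.y_sq k hj, zero_mul]
  have a1 : y j * (x j * (g * v)) = g * (y j * (x j * v)) := by
    refine smul_right_injective B (neg_ne_zero.mpr hp) ?_
    dsimp only
    rw [← mul_smul_comm, ← mul_assoc (x j), ← smul_mul_assoc, ← hgx, ← mul_assoc, ← mul_assoc,
      hyg j le_rfl, smul_mul_assoc, smul_mul_assoc]
    simp only [mul_assoc]
  have a2 : y j * (g * v) = (-p) • (g * (y j * v)) := by
    rw [← mul_assoc, hyg j le_rfl, smul_mul_assoc, mul_assoc]
  rw [h.nestedSum_mul hw hκ hj hgv, h.nestedSum_mul hw hκ hj hv, a1, hg _ h2, a2, mul_smul_comm,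
    hg _ h1]
  simp only [mul_smul_comm, mul_add, smul_add]
  rw [← mul_assoc g (x j), hgx, smul_mul_assoc, mul_assoc]
  simp only [smul_smul]
  congr 2 <;> ring_nf

/-- As `x j` squares to zero, one of the two summands of `nestedSum_mul` drops out on each side, and
the survivors differ by `μ j`. -/
lemma nestedSum_mul_x_self (h : IsFermiSystem p τ κ n x y t)
    (hw : ∀ i < n, w * x i = θ • (x i * w)) (hκ : ∀ j < n, κ j ≠ 0) {j : ℕ} (hj : j < n)
    {v : B} (hv : ∀ k < j, y k * v = 0) :
    nestedSum p θ κ μ n x y w j * (x j * v)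
      = μ j • (x j * (nestedSum p θ κ μ n x y w j * v)) := by
  have hgv : ∀ k < j, y k * (x j * v) = 0 := fun k hk => by
    rw [← mul_assoc, h.y_mul_x k j (by omega) hj (by omega), smul_mul_assoc, mul_assoc, hv k hk,
      mul_zero, smul_zero]
  rw [h.nestedSum_mul hw hκ hj hgv, h.nestedSum_mul hw hκ hj hv, ← mul_assoc (x j) (x j) v,
    h.x_sq j hj, mul_smul_comm, mul_add, mul_smul_comm, ← mul_assoc (x j) (x j), h.x_sq j hj]
  simp only [zero_mul, mul_zero, zero_add, smul_zero, add_zero]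
  rw [smul_comm]

lemma nestedSum_mul_y_self (h : IsFermiSystem p τ κ n x y t)
    (hw : ∀ i < n, w * x i = θ • (x i * w)) (hw' : ∀ i < n, y i * w = θ • (w * y i))
    (hp : p ≠ 0) (hθ : θ ≠ 0) (hκ : ∀ j < n, κ j ≠ 0) {j : ℕ} (hj : j < n) (hμ : μ j ≠ 0)
    {v : B} (hv : ∀ k < j, y k * v = 0) :
    nestedSum p θ κ μ n x y w j * (y j * v)
      = (μ j)⁻¹ • (y j * (nestedSum p θ κ μ n x y w j * v)) := by
  have hgv : ∀ k < j, y k * (y j * v) = 0 := fun k hk => by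
    rw [← mul_assoc, h.y_mul_y k j hk hj, smul_mul_assoc, mul_assoc, hv k hk, mul_zero, smul_zero]
  have e1 := h.anticomm_apply hj hgv
  rw [← mul_assoc (y j) (y j) v, h.y_sq j hj, zero_mul, mul_zero, zero_add] at e1
  -- After multiplication by `y j` the empty-site summand dies, and `e3` evaluates the occupied-site
  -- one as `κ j` times the inner sum.
  have e2 : y j * (nestedSum p θ κ μ n x y w (j + 1) * (y j * (x j * v))) = 0 := by
    rw [← mul_assoc, ← mul_assoc, h.y_mul_nestedSum_mul_y hw' hj, zero_mul]
  have e3 : y j * (x j * (nestedSum p θ κ μ n x y w (j + 1) * (y j * v)))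
      = κ j • (nestedSum p θ κ μ n x y w (j + 1) * (y j * v)) := by
    rw [← mul_assoc, ← mul_assoc, h.y_mul_x_mul_nestedSum hw hw' hp hθ hj, mul_assoc, mul_assoc,
      e1, mul_smul_comm]
  rw [h.nestedSum_mul hw hκ hj hgv, h.nestedSum_mul hw hκ hj hv, e1, ← mul_assoc (y j) (y j) v,
    h.y_sq j hj, mul_smul_comm (κ j)⁻¹, mul_add, e2, mul_smul_comm (μ j), e3]
  simp only [zero_mul, mul_zero, smul_zero, zero_add, add_zero, mul_smul_comm]
  rw [smul_comm (μ j), inv_smul_smul₀ (hκ j hj), inv_smul_smul₀ (hκ j hj), inv_smul_smul₀ hμ]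

/-- The nested sum intertwines the generators with their rescalings. -/
lemma nestedSum_mul_comm (h : IsFermiSystem p τ κ n x y t)
    (hw : ∀ i < n, w * x i = θ • (x i * w)) (hw' : ∀ i < n, y i * w = θ • (w * y i))
    (hwt : w * t = t * w) (hp : p ≠ 0) (hθ : θ ≠ 0) (hκ : ∀ j < n, κ j ≠ 0)
    (hμ : ∀ j < n, μ j ≠ 0) {d : ℕ} (hd : d ≤ n) {v : B} (hv : ∀ k < n - d, y k * v = 0) :
    (∀ i < n, n - d ≤ i → nestedSum p θ κ μ n x y w (n - d) * (x i * v)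
      = μ i • (x i * (nestedSum p θ κ μ n x y w (n - d) * v))) ∧
    (∀ i < n, n - d ≤ i → nestedSum p θ κ μ n x y w (n - d) * (y i * v)
      = (μ i)⁻¹ • (y i * (nestedSum p θ κ μ n x y w (n - d) * v))) ∧
    nestedSum p θ κ μ n x y w (n - d) * (t * v)
      = t * (nestedSum p θ κ μ n x y w (n - d) * v) := by
  induction d generalizing v with
  | zero =>
    refine ⟨fun i h1 h2 => by omega, fun i h1 h2 => by omega, ?_⟩
    rw [Nat.sub_zero, nestedSum_self, ← mul_assoc, hwt, mul_assoc]
  | succ d ih =>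
    obtain ⟨j, hj⟩ : ∃ j, n - (d + 1) = j := ⟨_, rfl⟩
    have hj' : n - d = j + 1 := by omega
    have hjn : j < n := by omega
    rw [hj] at hv ⊢
    rw [hj'] at ih
    have ih' := fun v hv => ih (by omega) (v := v) hv
    refine ⟨fun i hi hji => ?_, fun i hi hji => ?_, ?_⟩
    · rcases hji.eq_or_lt with rfl | hji
      · exact h.nestedSum_mul_x_self hw hκ hi hv
      · exact h.nestedSum_mul_comm_step hw hp hκ hjn (h.x_mul_x j i hji hi)
          (fun k hk => h.y_mul_x k i (by omega) hi (by omega))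
          (fun v hv => (ih' v hv).1 i hi (by omega)) hv
    · rcases hji.eq_or_lt with rfl | hji
      · exact h.nestedSum_mul_y_self hw hw' hp hθ hκ hi (hμ j hi) hv
      · exact h.nestedSum_mul_comm_step hw hp hκ hjn (h.y_mul_x i j hi hjn (by omega))
          (fun k hk => h.y_mul_y k i (by omega) hi)
          (fun v hv => (ih' v hv).2.1 i hi (by omega)) hv
    · have := h.nestedSum_mul_comm_step hw hp hκ hjn (g := t) (m := 1) (h.t_mul_x j hjn)
          (fun k hk => h.y_mul_t k (by omega))
          (fun v hv => by rw [one_smul]; exact (ih' v hv).2.2) hv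
      rwa [one_smul] at this

/-- On a vacuum vector every site is empty, so each step of the recursion is the identity. -/
lemma nestedSum_mul_of_killed (h : IsFermiSystem p τ κ n x y t)
    (hw : ∀ i < n, w * x i = θ • (x i * w)) (hκ : ∀ j < n, κ j ≠ 0) {v : B}
    (hv : ∀ k < n, y k * v = 0) {d : ℕ} (hd : d ≤ n) :
    nestedSum p θ κ μ n x y w (n - d) * v = w * v := by
  induction d with
  | zero => rw [Nat.sub_zero, nestedSum_self]
  | succ d ih =>
    have hj : n - d = n - (d + 1) + 1 := by omega
    have hjn : n - (d + 1) < n := by omega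
    have e := h.anticomm_apply hjn (v := v) fun k hk => hv k (by omega)
    rw [hv _ hjn, mul_zero, zero_add] at e
    rw [h.nestedSum_mul hw hκ hjn (fun k hk => hv k (by omega)), e, hv _ hjn, ← hj,
      mul_smul_comm, ih (by omega)]
    simp [hκ _ hjn]

end IsFermiSystem

end

/-! ### A Jordan–Wigner representation -/

/-- The eigenvalue of the string operator: a factor `-p` for each occupied site below `j`. -/
def stringSign (p : ℂ) (j : ℕ) (s : Finset ℕ) : ℂ :=
  ∏ k ∈ range j, if k ∈ s then -p else 1

/-- Creation operators on functions of the occupied sites. -/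
def creation (p : ℂ) (j : ℕ) : Module.End ℂ (Finset ℕ → ℂ) where
  toFun f s := if j ∈ s then stringSign p j s * f (s.erase j) else 0
  map_add' f g := by ext s; simp only [Pi.add_apply]; split_ifs <;> ring
  map_smul' c f := by
    ext s; simp only [Pi.smul_apply, smul_eq_mul, RingHom.id_apply]; split_ifs <;> ring

/-- Annihilation operators on functions of the occupied sites. -/
def annihilation (p : ℂ) (κ : ℕ → ℂ) (j : ℕ) : Module.End ℂ (Finset ℕ → ℂ) where
  toFun f s := if j ∈ s then 0 else κ j * stringSign p j s * f (insert j s)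
  map_add' f g := by ext s; simp only [Pi.add_apply]; split_ifs <;> ring
  map_smul' c f := by
    ext s; simp only [Pi.smul_apply, smul_eq_mul, RingHom.id_apply]; split_ifs <;> ring

/-- The multiple by `c` of the string operator. -/
def stringOp (p c : ℂ) (n : ℕ) : Module.End ℂ (Finset ℕ → ℂ) where
  toFun f s := c * stringSign p n s * f s
  map_add' f g := by ext s; simp only [Pi.add_apply]; ring
  map_smul' a f := by
    ext s; simp only [Pi.smul_apply, smul_eq_mul, RingHom.id_apply]; ring

section

variable {p : ℂ}

lemma stringSign_insert_of_lt {i j : ℕ} (h : i < j) {s : Finset ℕ} (hs : i ∉ s) :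
    stringSign p j (insert i s) = -p * stringSign p j s := by
  have hi : i ∈ range j := mem_range.mpr h
  rw [stringSign, stringSign, ← mul_prod_erase _ _ hi, ← mul_prod_erase _ _ hi,
    if_pos (mem_insert_self i s), if_neg hs, one_mul]
  congr 1
  refine prod_congr rfl fun k hk => ?_
  simp [ne_of_mem_erase hk]

lemma stringSign_insert_of_le {i j : ℕ} (h : j ≤ i) (s : Finset ℕ) :
    stringSign p j (insert i s) = stringSign p j s := by
  refine prod_congr rfl fun k hk => ?_
  have : k ≠ i := by have := mem_range.mp hk; omega
  simp [this]

lemma stringSign_of_lt {i j : ℕ} (h : i < j) {s : Finset ℕ} (hs : i ∈ s) :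
    stringSign p j s = -p * stringSign p j (s.erase i) := by
  rw [← stringSign_insert_of_lt h (notMem_erase i s), insert_erase hs]

lemma stringSign_erase_of_le {i j : ℕ} (h : j ≤ i) (s : Finset ℕ) :
    stringSign p j (s.erase i) = stringSign p j s := by
  refine prod_congr rfl fun k hk => ?_
  have : k ≠ i := by have := mem_range.mp hk; omega
  simp [this]

/-- The sum telescopes: an occupied site multiplies the squared string by `p ^ 2`. This is what
makes the correction in the anticommutator act as a squared string. -/
lemma stringSign_sq (j : ℕ) (s : Finset ℕ) : stringSign p j s ^ 2
    = 1 + (p ^ 2 - 1) * ∑ k ∈ range j, if k ∈ s then stringSign p k s ^ 2 else 0 := by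
  induction j with
  | zero => simp [stringSign]
  | succ j ih =>
    have h1 : stringSign p (j + 1) s = stringSign p j s * if j ∈ s then -p else 1 :=
      prod_range_succ _ _
    rw [sum_range_succ, mul_add, ← add_assoc, ← ih, h1]
    split_ifs <;> ring

lemma creation_annihilation {κ : ℕ → ℂ} (k : ℕ) (f : Finset ℕ → ℂ)
    (s : Finset ℕ) : (creation p k * annihilation p κ k) f s
      = κ k * (if k ∈ s then stringSign p k s ^ 2 else 0) * f s := by
  by_cases hs : k ∈ s
  · simp [creation, annihilation, hs, stringSign_erase_of_le]
    ring
  · simp [creation, annihilation, hs]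

lemma annihilation_creation {κ : ℕ → ℂ} (k : ℕ) (f : Finset ℕ → ℂ)
    (s : Finset ℕ) : (annihilation p κ k * creation p k) f s
      = κ k * (if k ∈ s then 0 else stringSign p k s ^ 2) * f s := by
  by_cases hs : k ∈ s
  · simp [creation, annihilation, hs]
  · simp [creation, annihilation, hs, stringSign_insert_of_le]
    ring

lemma vacuumSum_apply {κ : ℕ → ℂ} (m : ℕ) (hκ : ∀ j < m, κ j ≠ 0) (f : Finset ℕ → ℂ)
    (s : Finset ℕ) :
    ((1 + (p ^ 2 - 1) • ∑ k ∈ range m, (κ k)⁻¹ • (creation p k * annihilation p κ k) :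
      Module.End ℂ (Finset ℕ → ℂ)) f) s = stringSign p m s ^ 2 * f s := by
  rw [stringSign_sq, LinearMap.add_apply, LinearMap.smul_apply, LinearMap.sum_apply]
  simp only [Pi.add_apply, Pi.smul_apply, Finset.sum_apply, LinearMap.smul_apply,
    creation_annihilation, Module.End.one_apply, smul_eq_mul]
  rw [add_mul, one_mul, mul_assoc, sum_mul]
  congr 2
  refine sum_congr rfl fun k hk => ?_
  rw [← mul_assoc, ← mul_assoc, inv_mul_cancel₀ (hκ k (mem_range.mp hk)), one_mul]

lemma isFermiSystem_creation (c : ℂ) {κ : ℕ → ℂ} {n : ℕ} (hκ : ∀ j < n, κ j ≠ 0) :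
    IsFermiSystem p (c ^ 2) κ n (creation p) (annihilation p κ) (stringOp p c n) where
  x_sq i _ := by ext f s; simp [creation]
  y_sq i _ := by ext f s; simp [annihilation]
  x_mul_x i j hij hj := by
    refine LinearMap.ext fun f => funext fun s => ?_
    simp only [Module.End.mul_apply, LinearMap.smul_apply, Pi.smul_apply, smul_eq_mul, creation,
      LinearMap.coe_mk, AddHom.coe_mk, mem_erase]
    by_cases hi : i ∈ s <;> by_cases hj : j ∈ s <;> simp [hi, hj, hij.ne, hij.ne']
    rw [stringSign_of_lt hij hi, stringSign_erase_of_le hij.le, erase_right_comm]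
    ring
  y_mul_y i j hij hj := by
    refine LinearMap.ext fun f => funext fun s => ?_
    simp only [Module.End.mul_apply, LinearMap.smul_apply, Pi.smul_apply, smul_eq_mul,
      annihilation, LinearMap.coe_mk, AddHom.coe_mk, mem_insert]
    by_cases hi : i ∈ s <;> by_cases hj : j ∈ s <;> simp [hi, hj, hij.ne, hij.ne']
    rw [stringSign_insert_of_lt hij hi, stringSign_insert_of_le hij.le, Finset.insert_comm]
    ring
  y_mul_x i j hi hj hij := by
    refine LinearMap.ext fun f => funext fun s => ?_
    simp only [Module.End.mul_apply, LinearMap.smul_apply, Pi.smul_apply, smul_eq_mul,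
      annihilation, creation, LinearMap.coe_mk, AddHom.coe_mk, mem_insert, mem_erase]
    by_cases hi : i ∈ s <;> by_cases hj : j ∈ s <;> simp [hi, hj, hij, hij.symm]
    rw [erase_insert_of_ne hij]
    rcases lt_or_gt_of_ne hij with hlt | hlt
    · rw [stringSign_insert_of_lt hlt hi, stringSign_erase_of_le hlt.le]
      ring
    · rw [stringSign_insert_of_le hlt.le, stringSign_of_lt hlt hj]
      ring
  t_mul_x i hi := by
    refine LinearMap.ext fun f => funext fun s => ?_
    simp only [Module.End.mul_apply, LinearMap.smul_apply, Pi.smul_apply, smul_eq_mul,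
      stringOp, creation, LinearMap.coe_mk, AddHom.coe_mk]
    by_cases hs : i ∈ s <;> simp [hs]
    rw [stringSign_of_lt hi hs]
    ring
  y_mul_t i hi := by
    refine LinearMap.ext fun f => funext fun s => ?_
    simp only [Module.End.mul_apply, LinearMap.smul_apply, Pi.smul_apply, smul_eq_mul,
      stringOp, annihilation, LinearMap.coe_mk, AddHom.coe_mk]
    by_cases hs : i ∈ s <;> simp [hs]
    rw [stringSign_insert_of_lt hi hs]
    ring
  anticomm j hj := by
    refine LinearMap.ext fun f => funext fun s => ?_
    rw [LinearMap.add_apply, LinearMap.smul_apply, Pi.add_apply, Pi.smul_apply,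
      vacuumSum_apply j (fun k hk => hκ k (by omega)), creation_annihilation,
      annihilation_creation, smul_eq_mul]
    split_ifs <;> ring
  t_sq := by
    refine LinearMap.ext fun f => funext fun s => ?_
    rw [LinearMap.smul_apply, Pi.smul_apply, vacuumSum_apply n hκ]
    simp only [Module.End.mul_apply, stringOp, LinearMap.coe_mk, AddHom.coe_mk, smul_eq_mul]
    ring

end

/-! ### Reduced form of the Clifford relations -/

section

variable {B : Type*} [Ring B] [Algebra ℂ B] {N : ℕ}

/-- The summands `C^{k k'} γ_k γ_{k'}` of the metric relation. -/
def metricTerm (q : ℂ) (g : Fin N → B) (k : ℕ) : B :=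
  if h : k < N then q ^ (-twoRho (⟨k, h⟩ : Fin N)) • (g ⟨k, h⟩ * g (Fin.rev ⟨k, h⟩)) else 0

/-- The normalised partial sums of the metric relation. -/
def metricPartial (q c2 : ℂ) (g : Fin N → B) (m : ℕ) : B :=
  (c2 * (1 + q ^ (-2 : ℤ))) • 1 + (q ^ (2 : ℤ) - q ^ (-2 : ℤ)) • ∑ k ∈ range m, metricTerm q g k

lemma sum_metricC (q : ℂ) (g : Fin N → B) (k : Fin N) :
    ∑ l, metricC q k l • (g k * g l) = metricTerm q g k := by
  rw [sum_eq_single k.rev]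
  · simp [metricC, metricTerm]
  · intro l _ hl
    have : k ≠ l.rev := fun h => hl (by rw [h, Fin.rev_rev])
    simp [metricC, this]
  · simp

lemma sum_sum_metricC (q : ℂ) (g : Fin N → B) :
    ∑ k, ∑ l, metricC q k l • (g k * g l) = ∑ k ∈ range N, metricTerm q g k := by
  simp only [sum_metricC, sum_range]

lemma sum_sum_ite_lt_metricC (q : ℂ) (g : Fin N → B) (j : Fin N) :
    ∑ k, ∑ l, (if k < j then metricC q k l else 0) • (g k * g l)
      = ∑ k ∈ range j, metricTerm q g k := by
  have h1 : ∀ k : Fin N, ∑ l, (if k < j then metricC q k l else 0) • (g k * g l)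
      = if (k : ℕ) < j then metricTerm q g k else 0 := by
    intro k
    by_cases h : k < j
    · simp only [if_pos h, sum_metricC, if_pos (show (k : ℕ) < j from h)]
    · simp only [if_neg h, zero_smul, sum_const_zero, if_neg (show ¬ (k : ℕ) < j from h)]
  rw [sum_congr rfl fun k _ => h1 k, ← sum_range fun k => if k < (j : ℕ) then metricTerm q g k
    else 0, ← sum_filter]
  refine sum_congr ?_ fun _ _ => rfl
  ext k
  simp only [mem_filter, mem_range]
  have := j.2
  omega

lemma sum_sum_ite_eq (f : Fin N → Fin N → B) (i j : Fin N) (c : Fin N → Fin N → ℂ) :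
    ∑ k, ∑ l, (if k = i ∧ l = j then c k l else 0) • f k l = c i j • f i j := by
  rw [sum_eq_single i, sum_eq_single j]
  · simp
  · intro l _ hl; simp [hl]
  · simp
  · intro k _ hk; simp [hk]
  · simp

lemma sum_sum_projPlus (q : ℂ) (g : Fin N → B) (i j : Fin N) :
    ∑ k, ∑ l, projPlus N q (k, l) (i, j) • (g k * g l)
      = (q ^ (2 : ℤ) + q ^ (-2 : ℤ))⁻¹ • (q ^ (-2 : ℤ) • (g i * g j)
        + q ^ (2 * (if j = i then (1 : ℤ) else 0) - 2 * (if j = i.rev then (1 : ℤ) else 0))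
          • (g j * g i)
        + (if i < j then q ^ (2 : ℤ) - q ^ (-2 : ℤ) else 0) • (g i * g j)
        - metricC q i j • ((q ^ (2 : ℤ) - q ^ (-2 : ℤ)) • ∑ k ∈ range j, metricTerm q g k
          + (((q + q⁻¹) * (q - q⁻¹)) / (q ^ (2 * N) - 1)) • ∑ k ∈ range N, metricTerm q g k)) := by
  rw [← sum_sum_metricC, ← sum_sum_ite_lt_metricC]
  have e1 := sum_sum_ite_eq (fun k l => g k * g l) i j fun _ _ => q ^ (-2 : ℤ)
  have e2 := sum_sum_ite_eq (fun k l => g k * g l) j i fun k l =>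
    q ^ (2 * (if k = l then (1 : ℤ) else 0) - 2 * (if k = l.rev then (1 : ℤ) else 0))
  have e3 := sum_sum_ite_eq (fun k l => g k * g l) i j fun k _ =>
    if k < j then q ^ (2 : ℤ) - q ^ (-2 : ℤ) else 0
  rw [← e1, ← e2, ← e3]
  simp only [smul_sum, ← sum_add_distrib, ← sum_sub_distrib]
  refine sum_congr rfl fun k _ => sum_congr rfl fun l _ => ?_
  simp only [smul_smul, ← add_smul, ← sub_smul]
  congr 1
  simp only [projPlus, matR, matK, Matrix.smul_apply, Matrix.sub_apply, Matrix.add_apply,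
    Matrix.one_apply, smul_eq_mul, Prod.mk.injEq]
  congr 1
  split_ifs <;> ring

/-- The Clifford relations for a family `g`. -/
def CliffordRelations (q c2 : ℂ) (g : Fin N → B) : Prop :=
  (∀ i j, ∑ k, ∑ l, projPlus N q (k, l) (i, j) • (g k * g l) = 0) ∧
    ∑ k, ∑ l, metricC q k l • (g k * g l) = algebraMap ℂ B (c2 * ((q ^ (2 * N) - 1) / (q ^ 2 - 1)))

lemma metricPartial_zero (q c2 : ℂ) (g : Fin N → B) :
    metricPartial q c2 g 0 = (c2 * (1 + q ^ (-2 : ℤ))) • 1 := by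
  simp [metricPartial]

lemma metricPartial_succ (q c2 : ℂ) (g : Fin N → B) (m : ℕ) : metricPartial q c2 g (m + 1)
    = metricPartial q c2 g m + (q ^ (2 : ℤ) - q ^ (-2 : ℤ)) • metricTerm q g m := by
  rw [metricPartial, metricPartial, sum_range_succ, smul_add, add_assoc]

/-- Once the metric relation is granted, the full `matK` term of the projector is the scalar `c2 *
(1 + q ^ (-2))`; together with the truncated `matK` term from the braiding it forms `metricPartial`.
-/
lemma cliffordRelations_iff {q c2 : ℂ} (hq : q ≠ 0) (h2 : q ^ 2 ≠ 1) (h4 : q ^ 4 ≠ -1)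
    (hN : q ^ (2 * N) ≠ 1) (g : Fin N → B) :
    CliffordRelations q c2 g ↔ (∀ i j, q ^ (-2 : ℤ) • (g i * g j)
        + q ^ (2 * (if j = i then (1 : ℤ) else 0) - 2 * (if j = i.rev then (1 : ℤ) else 0))
          • (g j * g i)
        + (if i < j then q ^ (2 : ℤ) - q ^ (-2 : ℤ) else 0) • (g i * g j)
        = metricC q i j • metricPartial q c2 g j) ∧
      ∑ k ∈ range N, metricTerm q g k = (c2 * ((q ^ (2 * N) - 1) / (q ^ 2 - 1))) • 1 := by
  rw [CliffordRelations, sum_sum_metricC, Algebra.algebraMap_eq_smul_one]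
  refine and_congr_left fun hm => forall_congr' fun i => forall_congr' fun j => ?_
  have hne : (q ^ (2 : ℤ) + q ^ (-2 : ℤ))⁻¹ ≠ 0 := by
    refine inv_ne_zero fun h => h4 ?_
    have : q ^ (-2 : ℤ) = (q ^ 2)⁻¹ := by rw [zpow_neg]; norm_cast
    rw [this] at h
    have h' : q ^ (2 : ℤ) = q ^ 2 := by norm_cast
    rw [h'] at h
    field_simp at h
    linear_combination h
  have hs : ((q ^ (2 : ℤ) - q ^ (-2 : ℤ)) • ∑ k ∈ range j, metricTerm q g k
          + (((q + q⁻¹) * (q - q⁻¹)) / (q ^ (2 * N) - 1)) • ∑ k ∈ range N, metricTerm q g k)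
      = metricPartial q c2 g j := by
    rw [hm, smul_smul, metricPartial, add_comm]
    congr 2
    have : q ^ (-2 : ℤ) = (q ^ 2)⁻¹ := by rw [zpow_neg]; norm_cast
    rw [this]
    have a := sub_ne_zero.mpr h2
    have b := sub_ne_zero.mpr hN
    field_simp
  rw [sum_sum_projPlus, hs, smul_eq_zero, or_iff_right hne, sub_eq_zero]

/-- A reduced form of the Clifford relations. -/
structure IsReduced (q c2 : ℂ) (g : Fin N → B) : Prop where
  sq : ∀ i, i ≠ i.rev → g i * g i = 0
  comm : ∀ i j, i < j → j ≠ i.rev → g j * g i = (-q ^ 2) • (g i * g j)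
  anticomm : ∀ i, i < i.rev →
    g i * g i.rev + g i.rev * g i = q ^ (2 + twoRho i) • metricPartial q c2 g i
  mid : ∀ i, i = i.rev → (1 + q ^ (-2 : ℤ)) • (g i * g i) = metricPartial q c2 g i

lemma twoRho_of_lt {i : Fin N} (h : i < i.rev) : twoRho i = (N : ℤ) - 2 * ((i : ℤ) + 1) :=
  if_pos h

lemma twoRho_rev (i : Fin N) : twoRho i.rev = -twoRho i := by
  simp only [twoRho, Fin.rev_rev]
  split_ifs <;> first | ring1 | (exfalso; order)

lemma metricC_rev (q : ℂ) (i : Fin N) : metricC q i i.rev = q ^ (-twoRho i) := by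
  simp [metricC]

lemma metricC_of_ne (q : ℂ) {i j : Fin N} (h : j ≠ i.rev) : metricC q i j = 0 := by
  rw [metricC, if_neg fun h' => h (by rw [h', Fin.rev_rev])]

lemma metricTerm_eq (q : ℂ) (g : Fin N → B) (i : Fin N) :
    metricTerm q g i = q ^ (-twoRho i) • (g i * g i.rev) := by
  simp [metricTerm]

lemma IsReduced.of_cliffordRelations {q c2 : ℂ} (hq : q ≠ 0) (h2 : q ^ 2 ≠ 1) (h4 : q ^ 4 ≠ -1)
    (hN : q ^ (2 * N) ≠ 1) {g : Fin N → B} (h : CliffordRelations q c2 g) :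
    IsReduced q c2 g := by
  have hr := ((cliffordRelations_iff hq h2 h4 hN g).mp h).1
  have hm2 : q ^ (-2 : ℤ) = (q ^ 2)⁻¹ := by rw [zpow_neg]; norm_cast
  have hp2 : q ^ (2 : ℤ) = q ^ 2 := by norm_cast
  refine ⟨fun i hi => ?_, fun i j hij hj => ?_, fun i hi => ?_, fun i hi => ?_⟩
  · have := hr i i
    rw [metricC_of_ne q hi, if_pos rfl, if_neg hi, if_neg (lt_irrefl i), zero_smul, zero_smul,
      add_zero, ← add_smul] at this
    refine (smul_eq_zero.mp this).resolve_left fun h => h4 ?_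
    norm_num at h
    field_simp at h
    linear_combination h
  · have := hr i j
    rw [metricC_of_ne q hj, if_neg hij.ne', if_neg hj, if_pos hij, zero_smul] at this
    norm_num at this
    rw [add_right_comm, ← add_smul, add_sub_cancel] at this
    rw [neg_smul, eq_neg_iff_add_eq_zero, add_comm]
    exact this
  · have := hr i.rev i
    have hC : metricC q i.rev i = q ^ twoRho i := by
      simpa [twoRho_rev] using metricC_rev q i.rev
    rw [hC, if_neg hi.ne, Fin.rev_rev, if_pos rfl, if_neg hi.not_gt, zero_smul, add_zero] at this
    norm_num at this
    rw [zpow_add₀ hq, mul_smul, ← this, smul_add, hp2, smul_inv_smul₀ (pow_ne_zero 2 hq),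
      smul_inv_smul₀ (pow_ne_zero 2 hq), add_comm]
  · have := hr i i
    have hC : metricC q i i = 1 := by
      have h0 : twoRho i = 0 := by
        rw [twoRho, if_neg (by rw [← hi]; exact lt_irrefl i),
          if_neg (by rw [← hi]; exact lt_irrefl i)]
      have := metricC_rev q i
      rw [← hi, h0] at this
      simpa using this
    rw [hC, if_pos rfl, if_pos hi, if_neg (lt_irrefl i), zero_smul, add_zero, one_smul] at this
    norm_num at this
    rw [← this, add_smul, one_smul, add_comm]
    norm_num

namespace IsReduced

variable {q c2 : ℂ} {g : Fin N → B}

/-- A reflection symmetry of the partial sums, proved from the middle outwards: each step adds a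
multiple of γ_i γ_{i'} at one end and of γ_{i'} γ_i at the other, and the anticommutator converts
one into the other. It supplies the relations that `IsReduced` omits. -/
lemma metricPartial_sub (h : IsReduced q c2 g) (hq : q ≠ 0) {d : ℕ} (hd : d ≤ N / 2) :
    metricPartial q c2 g (N - (N / 2 - d))
      = q ^ (2 * ((N : ℤ) - 2 * ((N / 2 - d : ℕ) : ℤ))) • metricPartial q c2 g (N / 2 - d) := by
  induction d with
  | zero =>
    rw [Nat.sub_zero]
    rcases Nat.even_or_odd' N with ⟨n, hn | hn⟩
    · have e1 : N / 2 = n := by omega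
      have e2 : N - n = n := by omega
      have e3 : (N : ℤ) - 2 * (n : ℤ) = 0 := by omega
      rw [e1, e2, e3]
      simp
    · have e1 : N / 2 = n := by omega
      have e2 : N - n = n + 1 := by omega
      have e3 : (N : ℤ) - 2 * (n : ℤ) = 1 := by omega
      have hi : (⟨n, by omega⟩ : Fin N) = Fin.rev ⟨n, by omega⟩ := by
        ext; simp only [Fin.val_rev]; omega
      have h1 := h.mid _ hi
      have h3 : metricTerm q g n = g ⟨n, by omega⟩ * g ⟨n, by omega⟩ := by
        have h0 : twoRho (⟨n, by omega⟩ : Fin N) = 0 := by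
          rw [twoRho, if_neg (by rw [← hi]; exact lt_irrefl _),
            if_neg (by rw [← hi]; exact lt_irrefl _)]
        have := metricTerm_eq q g ⟨n, by omega⟩
        rw [h0, ← hi] at this
        simpa using this
      dsimp only at h1
      -- If S is the sum before the middle term and γ the middle generator, S = (1 + q⁻²) γ², so
      -- adding (q² - q⁻²) γ² gives (1 + q²) γ² = q² S.
      rw [e1, e2, e3, metricPartial_succ, ← h1, h3, smul_smul, ← add_smul]
      congr 1
      simp only [mul_one, mul_add, ← zpow_add₀ hq]
      norm_num
      rw [add_comm]
  | succ d ih =>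
    have ih := ih (by omega)
    obtain ⟨j, hj⟩ : ∃ j, N / 2 - (d + 1) = j := ⟨_, rfl⟩
    have hj' : N / 2 - d = j + 1 := by omega
    have hjN : j < N := by omega
    rw [hj]
    rw [hj'] at ih
    obtain ⟨i, rfl⟩ : ∃ i : Fin N, (i : ℕ) = j := ⟨⟨j, hjN⟩, rfl⟩
    have hi : i < i.rev := by rw [Fin.lt_def, Fin.val_rev]; omega
    have e1 : N - (i : ℕ) = (i.rev : ℕ) + 1 := by rw [Fin.val_rev]; omega
    have e2 : N - ((i : ℕ) + 1) = (i.rev : ℕ) := by rw [Fin.val_rev]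
    have hρ : (N : ℤ) - 2 * ((i : ℕ) : ℤ) = twoRho i + 2 := by rw [twoRho_of_lt hi]; ring
    have hρ' : (N : ℤ) - 2 * (((i : ℕ) + 1 : ℕ) : ℤ) = twoRho i := by
      rw [twoRho_of_lt hi]; push_cast; ring
    have hyx : g i.rev * g i = q ^ (2 + twoRho i) • metricPartial q c2 g i - g i * g i.rev := by
      rw [← h.anticomm i hi]; abel
    have hq4 : q ^ (2 * (twoRho i + 2)) = q ^ twoRho i * q ^ twoRho i * q ^ 4 := by
      rw [← zpow_add₀ hq, ← zpow_natCast, ← zpow_add₀ hq]; congr 1; push_cast; ring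
    rw [e2, hρ'] at ih
    rw [e1, hρ, metricPartial_succ, ih, metricPartial_succ, metricTerm_eq, metricTerm_eq,
      Fin.rev_rev, hyx, twoRho_rev, neg_neg, hq4]
    simp only [smul_sub, smul_add, smul_smul, two_mul (twoRho i), zpow_add₀ hq, zpow_neg]
    have := zpow_ne_zero (twoRho i) hq
    match_scalars <;> field_simp <;> ring

lemma cliffordRelations (h : IsReduced q c2 g) (hq : q ≠ 0) (h2 : q ^ 2 ≠ 1) (h2' : q ^ 2 ≠ -1)
    (h4 : q ^ 4 ≠ -1) (hN : q ^ (2 * N) ≠ 1) : CliffordRelations q c2 g := by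
  have hm2 : q ^ (-2 : ℤ) = (q ^ 2)⁻¹ := by rw [zpow_neg]; norm_cast
  have hp2 : q ^ (2 : ℤ) = q ^ 2 := by norm_cast
  have hq2 : q ^ 2 ≠ 0 := pow_ne_zero 2 hq
  rw [cliffordRelations_iff hq h2 h4 hN]
  constructor
  · intro i j
    by_cases hj : j = i.rev
    · subst hj
      rw [metricC_rev, if_pos rfl]
      rcases lt_trichotomy i i.rev with hi | hi | hi
      · have hd := h.metricPartial_sub hq (d := N / 2 - (i + 1)) (by omega)
        have hiv : (i : ℕ) < N - (i + 1) := by rw [← Fin.val_rev]; exact hi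
        have e0 : N / 2 - (N / 2 - ((i : ℕ) + 1)) = i + 1 := by omega
        have hρ' : (N : ℤ) - 2 * (((i : ℕ) + 1 : ℕ) : ℤ) = twoRho i := by
          rw [twoRho_of_lt hi]; push_cast; ring
        have hyx : g i.rev * g i
            = q ^ (2 + twoRho i) • metricPartial q c2 g i - g i * g i.rev := by
          rw [← h.anticomm i hi]; abel
        rw [e0, hρ', ← Fin.val_rev, metricPartial_succ, metricTerm_eq] at hd
        rw [hd, if_neg hi.ne', if_pos hi, hyx]
        simp only [smul_sub, smul_add, smul_smul, two_mul (twoRho i), zpow_add₀ hq, zpow_neg]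
        norm_num
        have := zpow_ne_zero (twoRho i) hq
        match_scalars <;> field_simp
      · have := h.mid i hi
        have h0 : twoRho i = 0 := by
          rw [twoRho, if_neg (by rw [← hi]; exact lt_irrefl _),
            if_neg (by rw [← hi]; exact lt_irrefl _)]
        rw [← hi, h0, ← this]
        norm_num
        rw [add_smul, one_smul, add_comm]
      · have := h.anticomm i.rev (by rwa [Fin.rev_rev])
        rw [Fin.rev_rev, twoRho_rev, zpow_add₀ hq, mul_smul] at this
        rw [if_neg hi.ne, if_neg hi.not_gt, zero_smul, add_zero]
        norm_num
        rw [← smul_add, inv_smul_eq_iff₀ hq2, add_comm, this, hp2, zpow_neg,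
          Fin.val_rev]
    · rw [metricC_of_ne q hj, zero_smul, if_neg hj]
      rcases lt_trichotomy i j with hij | rfl | hij
      · rw [h.comm i j hij hj, if_neg hij.ne', if_pos hij]
        norm_num
        module
      · rw [h.sq i hj]
        simp
      · have hi : i ≠ j.rev := fun e => hj (by rw [e, Fin.rev_rev])
        rw [h.comm j i hij hi, if_neg hij.ne, if_neg hij.not_gt]
        norm_num
        rw [inv_smul_smul₀ hq2, neg_add_cancel]
  · have := h.metricPartial_sub hq le_rfl
    rw [Nat.sub_self, Nat.sub_zero, metricPartial_zero] at this
    have hne : q ^ (2 : ℤ) - q ^ (-2 : ℤ) ≠ 0 := by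
      intro h0
      rw [hm2, hp2] at h0
      field_simp at h0
      have h3 : (q ^ 2 - 1) * (q ^ 2 + 1) = 0 := by linear_combination h0
      rcases mul_eq_zero.mp h3 with h5 | h5
      · exact h2 (sub_eq_zero.mp h5)
      · exact h2' (by linear_combination h5)
    have hqN : q ^ (2 * ((N : ℤ) - 2 * ((0 : ℕ) : ℤ))) = q ^ (2 * N) := by
      rw [← zpow_natCast]; congr 1
    refine smul_right_injective B hne ?_
    dsimp only
    rw [metricPartial, ← eq_sub_iff_add_eq', hqN, smul_smul, ← sub_smul] at this
    rw [this, smul_smul]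
    congr 1
    rw [hm2, hp2]
    have := sub_ne_zero.mpr h2
    field_simp
    ring

end IsReduced

end

/-! ### From reduced relations to deformed fermions and back -/

/-- The anticommutator constants `c² (q + q⁻¹) q ^ (N + 1 - 2 i)`. -/
def anticommConst (N : ℕ) (q c2 : ℂ) (j : ℕ) : ℂ :=
  c2 * (q + q⁻¹) * q ^ ((N : ℤ) + 1 - 2 * ((j : ℤ) + 1))

section

variable {B : Type*} [Ring B] [Algebra ℂ B] {N : ℕ} {q c2 : ℂ} {g : Fin N → B} {x y : ℕ → B}
  {t : B}

lemma add_inv_ne_zero_of_sq (hq : q ≠ 0) (h2' : q ^ 2 ≠ -1) : q + q⁻¹ ≠ 0 := by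
  intro h
  field_simp at h
  exact h2' (by linear_combination h)

lemma anticommConst_ne_zero (hq : q ≠ 0) (h2' : q ^ 2 ≠ -1) (hc : c2 ≠ 0) (j : ℕ) :
    anticommConst N q c2 j ≠ 0 :=
  mul_ne_zero (mul_ne_zero hc (add_inv_ne_zero_of_sq hq h2')) (zpow_ne_zero _ hq)

lemma anticommConst_eq (hq : q ≠ 0) {i : Fin N} (hi : i < i.rev) :
    anticommConst N q c2 i = q ^ (2 + twoRho i) * (c2 * (1 + q ^ (-2 : ℤ))) := by
  have e : (N : ℤ) + 1 - 2 * ((i : ℤ) + 1) = twoRho i + 1 := by rw [twoRho_of_lt hi]; ring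
  have hm2 : q ^ (-2 : ℤ) = (q ^ 2)⁻¹ := by rw [zpow_neg]; norm_cast
  have hp2 : q ^ (2 : ℤ) = q ^ 2 := by norm_cast
  rw [anticommConst, e, zpow_add₀ hq, zpow_add₀ hq, zpow_one, hm2, hp2]
  field_simp

/-- The weights `q ^ (-twoRho i)` are, up to a common factor, the inverses of the anticommutator
constants; this identifies the partial metric sums with the fermionic corrections. -/
lemma metricPartial_eq (hq : q ≠ 0) (h2' : q ^ 2 ≠ -1) (hc : c2 ≠ 0)
    (hx : ∀ i : Fin N, i < i.rev → x i = g i) (hy : ∀ i : Fin N, i < i.rev → y i = g i.rev)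
    {m : ℕ} (hm : m ≤ N / 2) : metricPartial q c2 g m = (c2 * (1 + q ^ (-2 : ℤ))) •
      (1 + ((q ^ 2) ^ 2 - 1) • ∑ k ∈ range m, (anticommConst N q c2 k)⁻¹ • (x k * y k)) := by
  rw [metricPartial, smul_add, smul_smul, smul_sum, smul_sum]
  congr 1
  refine sum_congr rfl fun k hk => ?_
  have hkm := mem_range.mp hk
  obtain ⟨i, rfl⟩ : ∃ i : Fin N, (i : ℕ) = k := ⟨⟨k, by omega⟩, rfl⟩
  have hi : i < i.rev := by rw [Fin.lt_def, Fin.val_rev]; omega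
  rw [metricTerm_eq, hx i hi, hy i hi, anticommConst_eq hq hi, smul_smul, smul_smul]
  congr 1
  have hm2 : q ^ (-2 : ℤ) = (q ^ 2)⁻¹ := by rw [zpow_neg]; norm_cast
  have hp2 : q ^ (2 : ℤ) = q ^ 2 := by norm_cast
  rw [zpow_add₀ hq, hm2, hp2, zpow_neg]
  have h1 := zpow_ne_zero (twoRho i) hq
  have h3 : q ^ 2 + 1 ≠ 0 := fun h => h2' (by linear_combination h)
  field_simp

lemma IsReduced.isFermiSystem (h : IsReduced q c2 g) (hq : q ≠ 0) (h2' : q ^ 2 ≠ -1) (hc : c2 ≠ 0)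
    (hx : ∀ i : Fin N, i < i.rev → x i = g i) (hy : ∀ i : Fin N, i < i.rev → y i = g i.rev)
    (ht : ∀ i : Fin N, i = i.rev → t = g i) (ht' : Even N → t = 0) :
    IsFermiSystem (q ^ 2) (if Even N then 0 else c2) (anticommConst N q c2) (N / 2) x y t := by
  have low : ∀ j < N / 2, ∃ i : Fin N, (i : ℕ) = j ∧ i < i.rev := fun j hj =>
    ⟨⟨j, by omega⟩, rfl, by rw [Fin.lt_def, Fin.val_rev, Fin.val_mk]; omega⟩
  have mid : ¬ Even N → ∃ i : Fin N, (i : ℕ) = N / 2 ∧ i = i.rev := fun hN => by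
    obtain ⟨n, hn⟩ := Nat.not_even_iff_odd.mp hN
    exact ⟨⟨N / 2, by omega⟩, rfl, by ext; rw [Fin.val_rev, Fin.val_mk]; omega⟩
  refine ⟨fun j hj => ?_, fun j hj => ?_, fun i j hij hj => ?_, fun i j hij hj => ?_,
    fun i j hi hj hij => ?_, fun j hj => ?_, fun j hj => ?_, fun j hj => ?_, ?_⟩
  · obtain ⟨i, rfl, hi⟩ := low j hj
    rw [hx i hi, h.sq i hi.ne]
  · obtain ⟨i, rfl, hi⟩ := low j hj
    rw [hy i hi, h.sq i.rev (by rw [Fin.rev_rev]; exact hi.ne')]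
  · obtain ⟨i, rfl, hi⟩ := low i (by omega)
    obtain ⟨j, rfl, hj'⟩ := low j hj
    rw [hx i hi, hx j hj', h.comm i j hij]
    intro e
    have := congrArg Fin.val e
    rw [Fin.val_rev] at this
    omega
  · obtain ⟨i, rfl, hi⟩ := low i (by omega)
    obtain ⟨j, rfl, hj'⟩ := low j hj
    rw [hy i hi, hy j hj', h.comm j.rev i.rev (Fin.rev_lt_rev.mpr hij)]
    rw [Fin.rev_rev]
    intro e
    have := congrArg Fin.val e
    rw [Fin.val_rev] at this
    omega
  · obtain ⟨i, rfl, hi'⟩ := low i hi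
    obtain ⟨j, rfl, hj'⟩ := low j hj
    rw [hy i hi', hx j hj', h.comm j i.rev]
    · rw [Fin.lt_def, Fin.val_rev]; omega
    · intro e
      exact hij (congrArg Fin.val (Fin.rev_injective e))
  · by_cases hN : Even N
    · rw [ht' hN]; simp
    · obtain ⟨i, rfl, hi⟩ := low j hj
      obtain ⟨m, hm, hm'⟩ := mid hN
      rw [hx i hi, ht m hm', h.comm i m (by rw [Fin.lt_def]; omega)]
      rw [hm']
      intro e
      have := congrArg Fin.val (Fin.rev_injective e)
      omega
  · by_cases hN : Even N
    · rw [ht' hN]; simp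
    · obtain ⟨i, rfl, hi⟩ := low j hj
      obtain ⟨m, hm, hm'⟩ := mid hN
      have e1 : m < i.rev := by rw [hm', Fin.rev_lt_rev, Fin.lt_def]; omega
      rw [hy i hi, ht m hm', h.comm m i.rev e1]
      intro e
      have := congrArg Fin.val (Fin.rev_injective e)
      omega
  · obtain ⟨i, rfl, hi⟩ := low j hj
    have := metricPartial_eq hq h2' hc hx hy hj.le
    rw [hx i hi, hy i hi, h.anticomm i hi, this, anticommConst_eq hq hi, smul_smul]
  · split_ifs with hN
    · rw [ht' hN]; simp
    · obtain ⟨m, hm, hm'⟩ := mid hN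
      have hS : (1 + q ^ (-2 : ℤ)) ≠ 0 := by
        intro h0
        rw [zpow_neg] at h0
        norm_num at h0
        field_simp at h0
        exact h2' (by linear_combination h0)
      have e1 := h.mid m hm'
      rw [hm, metricPartial_eq hq h2' hc hx hy le_rfl, mul_comm, mul_smul] at e1
      rw [ht m hm']
      exact smul_right_injective B hS e1

lemma IsFermiSystem.isReduced {τ : ℂ}
    (h : IsFermiSystem (q ^ 2) τ (anticommConst N q c2) (N / 2) x y t)
    (hτ : τ = c2) (hq : q ≠ 0) (h2' : q ^ 2 ≠ -1) (hc : c2 ≠ 0)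
    (hx : ∀ i : Fin N, i < i.rev → x i = g i) (hy : ∀ i : Fin N, i < i.rev → y i = g i.rev)
    (ht : ∀ i : Fin N, i = i.rev → t = g i) : IsReduced q c2 g := by
  have hlow : ∀ i : Fin N, i < i.rev → (i : ℕ) < N / 2 := fun i hi => by
    rw [Fin.lt_def, Fin.val_rev] at hi; omega
  have hhigh : ∀ i : Fin N, i.rev < i → i.rev < i.rev.rev := fun i hi => by rwa [Fin.rev_rev]
  have hy' : ∀ i : Fin N, i.rev < i → g i = y i.rev := fun i hi => by
    rw [hy _ (hhigh i hi), Fin.rev_rev]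
  subst hτ
  refine ⟨fun i hi => ?_, fun i j hij hj => ?_, fun i hi => ?_, fun i hi => ?_⟩
  · rcases lt_or_gt_of_ne hi with hi | hi
    · rw [← hx i hi, h.x_sq _ (hlow i hi)]
    · rw [hy' i hi, h.y_sq _ (hlow _ (hhigh i hi))]
  · rcases lt_trichotomy i i.rev with hi | hi | hi
    · rcases lt_trichotomy j j.rev with hj' | hj' | hj'
      · rw [← hx i hi, ← hx j hj', h.x_mul_x i j hij (hlow j hj')]
      · rw [← hx i hi, ← ht j hj', h.t_mul_x i (hlow i hi)]
      · rw [← hx i hi, hy' j hj', h.y_mul_x _ _ (hlow _ (hhigh j hj')) (hlow i hi)]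
        intro e
        exact hj (by rw [← Fin.ext e, Fin.rev_rev])
    · rcases lt_trichotomy j j.rev with hj' | hj' | hj'
      · rw [Fin.lt_def] at hij hj'
        have := congrArg Fin.val hi
        rw [Fin.val_rev] at this hj'
        omega
      · have e1 := congrArg Fin.val hi
        have e2 := congrArg Fin.val hj'
        rw [Fin.val_rev] at e1 e2
        rw [Fin.lt_def] at hij
        omega
      · rw [← ht i hi, hy' j hj', h.y_mul_t _ (hlow _ (hhigh j hj'))]
    · have hj' : j.rev < j := by
        rw [Fin.lt_def, Fin.val_rev] at *; omega
      rw [hy' i hi, hy' j hj', h.y_mul_y _ _ (Fin.rev_lt_rev.mpr hij) (hlow _ (hhigh i hi))]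
  · have := metricPartial_eq hq h2' hc hx hy (hlow i hi).le
    rw [this, ← hx i hi, ← hy i hi, h.anticomm _ (hlow i hi), anticommConst_eq hq hi, smul_smul]
  · have hi' : (i : ℕ) = N / 2 := by
      have := congrArg Fin.val hi
      rw [Fin.val_rev] at this
      omega
    rw [hi', metricPartial_eq hq h2' hc hx hy le_rfl, ← ht i hi, h.t_sq, smul_smul, mul_comm]

lemma exists_isReduced (N : ℕ) (hq : q ≠ 0) (h2' : q ^ 2 ≠ -1) (hc : c2 ≠ 0) :
    ∃ g : Fin N → Module.End ℂ (Finset ℕ → ℂ), IsReduced q c2 g := by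
  -- A square root of `c2` normalises the string operator so that it can play the middle generator.
  obtain ⟨c, hc'⟩ := IsAlgClosed.exists_pow_nat_eq c2 two_pos
  have h := isFermiSystem_creation (p := q ^ 2) c (κ := anticommConst N q c2) (n := N / 2)
    fun j _ => anticommConst_ne_zero hq h2' hc j
  refine ⟨fun i => if i < i.rev then creation (q ^ 2) i else
    if i.rev < i then annihilation (q ^ 2) (anticommConst N q c2) i.rev
    else stringOp (q ^ 2) c (N / 2), h.isReduced hc' hq h2' hc ?_ ?_ ?_⟩
  · intro i hi
    rw [if_pos hi]
  · intro i hi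
    rw [Fin.rev_rev, if_neg hi.not_gt, if_pos hi]
  · intro i hi
    rw [if_neg (by rw [← hi]; exact lt_irrefl _), if_neg (by rw [← hi]; exact lt_irrefl _)]

end

lemma cliffordRelations_gen (N : ℕ) (q c2 : ℂ) : CliffordRelations q c2 (gen N q c2) := by
  constructor
  · intro i j
    have := RingQuot.mkAlgHom_rel ℂ (Rel.proj (N := N) (q := q) (c2 := c2) i j)
    simp only [map_sum, map_smul, map_mul, map_zero] at this
    exact this
  · have := RingQuot.mkAlgHom_rel ℂ (Rel.metric (N := N) (q := q) (c2 := c2))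
    simp only [map_sum, map_smul, map_mul, AlgHom.commutes] at this
    rw [map_mul]
    exact this

lemma nontrivial_Cl {N : ℕ} {q c2 : ℂ} (hq : q ≠ 0) (h2 : q ^ 2 ≠ 1) (h2' : q ^ 2 ≠ -1)
    (h4 : q ^ 4 ≠ -1) (hN : q ^ (2 * N) ≠ 1) (hc : c2 ≠ 0) : Nontrivial (Cl N q c2) := by
  obtain ⟨g, hg⟩ := exists_isReduced N hq h2' hc
  have hrel := hg.cliffordRelations hq h2 h2' h4 hN
  let φ : Cl N q c2 →ₐ[ℂ] Module.End ℂ (Finset ℕ → ℂ) :=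
    RingQuot.liftAlgHom ℂ ⟨FreeAlgebra.lift ℂ g, by
      intro a b hab
      cases hab with
      | proj i j => simpa [map_sum] using hrel.1 i j
      | metric => simpa [map_sum] using hrel.2⟩
  exact φ.toRingHom.domain_nontrivial

/-! ### Nested terms as explicit ordered products -/

section

variable {B : Type*} [Ring B] [Algebra ℂ B]

lemma nestedTerm_ofFn (p θ : ℂ) (κ μ : ℕ → ℂ) (x y : ℕ → B) (w : B) {k : ℕ} (f : Fin k → ℕ) :
    nestedTerm p θ κ μ x y w (List.ofFn f)
      = (∏ r, (μ (f r) - θ * p ^ (2 * (k - 1 - (r : ℕ)))) / κ (f r)) •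
        ((List.ofFn fun r => x (f r)).prod * w * (List.ofFn fun r => y (f r)).reverse.prod) := by
  induction k with
  | zero => simp [nestedTerm]
  | succ k ih =>
    have h1 : ∀ r : Fin k, k + 1 - 1 - ((r.succ : Fin (k + 1)) : ℕ) = k - 1 - r := fun r => by
      rw [Fin.val_succ]; omega
    rw [List.ofFn_succ, nestedTerm, ih, Fin.prod_univ_succ, List.ofFn_succ, List.ofFn_succ,
      List.length_ofFn, List.prod_cons, List.reverse_cons, List.prod_append, List.prod_singleton]
    simp only [h1, mul_smul_comm, smul_mul_assoc, smul_smul, mul_assoc]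
    simp

lemma ofFn_nth {m : ℕ} (s : Finset (Fin m)) :
    (List.ofFn fun r => (nth s r : ℕ)) = (s.map Fin.valEmbedding).sort (· ≤ ·) := by
  rw [← Finset.map_sort (f := Fin.valEmbedding) (r := (· ≤ ·)) (r' := (· ≤ ·)) (s := s)
    fun a _ b _ => Iff.rfl]
  refine List.ext_getElem (by simp) fun i h1 h2 => ?_
  simp [nth, Finset.orderEmbOfFin_apply]

lemma sum_powerset_Ico_zero {M : Type*} [AddCommMonoid M] (n : ℕ) (F : Finset ℕ → M) :
    ∑ s ∈ (Ico 0 n).powerset, F s = ∑ s : Finset (Fin n), F (s.map Fin.valEmbedding) := by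
  have h : (Ico 0 n).powerset
      = (univ : Finset (Finset (Fin n))).map (mapEmbedding Fin.valEmbedding).toEmbedding := by
    ext s
    simp only [mem_powerset, mem_map, mem_univ, true_and, RelEmbedding.coe_toEmbedding,
      mapEmbedding_apply]
    constructor
    · intro hs
      refine ⟨univ.filter fun i => (i : ℕ) ∈ s, ?_⟩
      ext i
      simp only [mem_map, mem_filter, mem_univ, true_and, Fin.valEmbedding_apply]
      constructor
      · rintro ⟨a, ha, rfl⟩; exact ha
      · intro hi
        exact ⟨⟨i, (mem_Ico.mp (hs hi)).2⟩, hi, rfl⟩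
    · rintro ⟨a, rfl⟩ i hi
      obtain ⟨b, _, rfl⟩ := mem_map.mp hi
      simp
  rw [h, sum_map]
  rfl

end

/-! ### The twisted centre of the Clifford algebra -/

section

variable (N : ℕ) (q c2 : ℂ)

/-- The generators of index at most `N / 2`. -/
def lowGen (j : ℕ) : Cl N q c2 := if h : j < N then gen N q c2 ⟨j, h⟩ else 0

/-- The generators paired with `lowGen`. -/
def highGen (j : ℕ) : Cl N q c2 := if h : j < N then gen N q c2 (Fin.rev ⟨j, h⟩) else 0

/-- The self-paired generator, which is present for odd `N` only. -/
def midGen : Cl N q c2 :=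
  if h : Odd N then gen N q c2 ⟨N / 2, Nat.div_lt_self h.pos one_lt_two⟩ else 0

/-- The parameters `μ` as a function on the natural numbers. -/
def muNat {N : ℕ} (μ : Fin (N / 2) → ℂˣ) (j : ℕ) : ℂ := if h : j < N / 2 then μ ⟨j, h⟩ else 1

variable {N q c2}

lemma lowGen_eq (i : Fin N) : lowGen N q c2 i = gen N q c2 i := dif_pos i.2

lemma highGen_eq (i : Fin N) : highGen N q c2 i = gen N q c2 i.rev := dif_pos i.2

lemma gen_eq_highGen_rev (i : Fin N) : gen N q c2 i = highGen N q c2 i.rev := by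
  rw [highGen_eq, Fin.rev_rev]

lemma val_of_eq_rev {i : Fin N} (hi : i = i.rev) : Odd N ∧ (i : ℕ) = N / 2 := by
  have := congrArg Fin.val hi
  rw [Fin.val_rev] at this
  exact ⟨⟨i, by omega⟩, by omega⟩

lemma midGen_eq {i : Fin N} (hi : i = i.rev) : midGen N q c2 = gen N q c2 i := by
  obtain ⟨h1, h2⟩ := val_of_eq_rev hi
  rw [midGen, dif_pos h1]
  congr 1
  ext
  exact h2.symm

lemma low_of_lt {i : Fin N} (hi : i < i.rev) : (i : ℕ) < N / 2 := by
  rw [Fin.lt_def, Fin.val_rev] at hi; omega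

lemma muNat_ne_zero (μ : Fin (N / 2) → ℂˣ) (j : ℕ) : muNat μ j ≠ 0 := by
  rw [muNat]; split_ifs <;> simp

lemma muExt_of_lt (μ : Fin (N / 2) → ℂˣ) {i : Fin N} (hi : i < i.rev) :
    (muExt μ i : ℂ) = muNat μ i := by
  rw [muExt, dif_pos hi, muNat, dif_pos (low_of_lt hi)]

lemma muExt_of_gt (μ : Fin (N / 2) → ℂˣ) {i : Fin N} (hi : i.rev < i) :
    (muExt μ i : ℂ) = (muNat μ i.rev)⁻¹ := by
  rw [muExt, dif_neg hi.not_gt, dif_pos hi, muNat, dif_pos (low_of_lt (by rwa [Fin.rev_rev])),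
    Units.val_inv_eq_inv_val]

lemma muExt_of_eq (μ : Fin (N / 2) → ℂˣ) {i : Fin N} (hi : i = i.rev) :
    (muExt μ i : ℂ) = 1 := by
  rw [muExt, dif_neg (by rw [← hi]; exact lt_irrefl _), dif_neg (by rw [← hi]; exact lt_irrefl _),
    Units.val_one]

lemma isFermiSystem_gen (hq : q ≠ 0) (h2 : q ^ 2 ≠ 1) (h2' : q ^ 2 ≠ -1)
    (h4 : q ^ 4 ≠ -1) (hN : q ^ (2 * N) ≠ 1) (hc : c2 ≠ 0) :
    IsFermiSystem (q ^ 2) (if Even N then 0 else c2) (anticommConst N q c2) (N / 2)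
      (lowGen N q c2) (highGen N q c2) (midGen N q c2) :=
  (IsReduced.of_cliffordRelations hq h2 h4 hN (cliffordRelations_gen N q c2)).isFermiSystem hq h2'
    hc (fun i _ => lowGen_eq i) (fun i _ => highGen_eq i) (fun _ hi => midGen_eq hi)
    fun h => dif_neg (Nat.not_odd_iff_even.mpr h)

lemma zElem_eq_nestedSum (hN3 : 3 ≤ N) (μ : Fin (N / 2) → ℂˣ) {η : Fin 2}
    (hη : η = 0 ∨ Odd N) :
    zElem N hN3 q c2 μ η = nestedSum (q ^ 2) ((-q ^ 2) ^ (η : ℕ)) (anticommConst N q c2) (muNat μ)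
      (N / 2) (lowGen N q c2) (highGen N q c2) (midGen N q c2 ^ (η : ℕ)) 0 := by
  have hmid : gen N q c2 ⟨N / 2, by omega⟩ ^ (η : ℕ) = midGen N q c2 ^ (η : ℕ) := by
    rcases hη with rfl | hη
    · simp
    · rw [midGen, dif_pos hη]
  rw [zElem, nestedSum, sum_powerset_Ico_zero]
  refine sum_congr rfl fun s _ => ?_
  rw [← ofFn_nth, nestedTerm_ofFn, zTerm, hmid]
  have hlow : ∀ r, lowGen N q c2 (nth s r : ℕ) = gen N q c2 (low (nth s r)) := fun r =>
    lowGen_eq (low (nth s r))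
  have hhigh : ∀ r, highGen N q c2 (nth s r : ℕ) = gen N q c2 (low (nth s r)).rev := fun r =>
    highGen_eq (low (nth s r))
  simp only [hlow, hhigh]
  congr 1
  refine prod_congr rfl fun r _ => ?_
  -- The exponent counts the elements of `s` after position `r`, which is zero-based; hence the
  -- shift by one on both sides.
  have hr : (q ^ 2) ^ (2 * (s.card - 1 - (r : ℕ)))
      = q ^ (4 * (s.card : ℤ) - 4 * (((r : ℕ) : ℤ) + 1)) := by
    have := r.2
    rw [← pow_mul, ← zpow_natCast]
    congr 1
    omega
  rw [hr, muNat, dif_pos (nth s r).2, anticommConst]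

/-- The twisted commutation passes from generators to words and sums. No automorphism has to be
constructed, as only z A ⊆ A z is needed. -/
lemma exists_mul_comm_of_mem_centerMu {μ : Fin (N / 2) → ℂˣ} {z : Cl N q c2}
    (hz : z ∈ centerMu N q c2 μ) (a : Cl N q c2) : ∃ b, z * a = b * z := by
  obtain ⟨a, rfl⟩ := RingQuot.mkAlgHom_surjective ℂ (Rel N q c2) a
  induction a using FreeAlgebra.induction with
  | grade0 r => exact ⟨algebraMap ℂ _ r, by rw [AlgHom.commutes, Algebra.commutes]⟩
  | grade1 i => exact ⟨(muExt μ i : ℂ) • gen N q c2 i, by rw [smul_mul_assoc]; exact hz i⟩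
  | mul a b iha ihb =>
    obtain ⟨a', ha⟩ := iha
    obtain ⟨b', hb⟩ := ihb
    exact ⟨a' * b', by rw [map_mul, ← mul_assoc, ha, mul_assoc, hb, mul_assoc]⟩
  | add a b iha ihb =>
    obtain ⟨a', ha⟩ := iha
    obtain ⟨b', hb⟩ := ihb
    exact ⟨a' + b', by rw [map_add, mul_add, ha, hb, add_mul]⟩

lemma zElem_mem_parity (hN3 : 3 ≤ N) (μ : Fin (N / 2) → ℂˣ) (η : Fin 2) :
    zElem N hN3 q c2 μ η ∈ parity N q c2 η := by
  refine Submodule.sum_mem _ fun s _ => Submodule.smul_mem _ _ (Submodule.subset_span ?_)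
  refine ⟨(List.ofFn fun r => low (nth s r)) ++ List.replicate η ⟨N / 2, by omega⟩
    ++ (List.ofFn fun r => (low (nth s r)).rev).reverse, ?_, ?_⟩
  · have := η.2
    simp only [List.length_append, List.length_ofFn, List.length_replicate, List.length_reverse]
    omega
  · rw [List.map_append, List.map_append, List.prod_append, List.prod_append, List.map_reverse,
      List.map_ofFn, List.map_ofFn, List.map_replicate, List.prod_replicate]
    rfl

/-- The full Fock module is stable under all generators, each of which flips the parity, so a word
acting on the vacuum lands in the component given by its length. -/
lemma mul_vacuum_mem_fock (hF : IsFermiSystem (q ^ 2) (if Even N then 0 else c2)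
    (anticommConst N q c2) (N / 2) (lowGen N q c2) (highGen N q c2) (midGen N q c2))
    {η : Fin 2} {z : Cl N q c2} (hz : z ∈ parity N q c2 η) :
    z * vacuum (highGen N q c2) (N / 2) ∈ fock (N / 2) (lowGen N q c2) (midGen N q c2)
      (vacuum (highGen N q c2) (N / 2)) (N / 2) η := by
  have hv := hF.y_mul_vacuum le_rfl
  induction hz using Submodule.span_induction with
  | mem x hx =>
    obtain ⟨w, hw, rfl⟩ := hx
    rw [← hw, fock_mod_two]
    clear hw
    induction w with
    | nil =>
      have : ∀ d, vacuum (highGen N q c2) (N / 2) ∈ fock (N / 2) (lowGen N q c2) (midGen N q c2)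
          (vacuum (highGen N q c2) (N / 2)) d 0 := by
        intro d
        induction d with
        | zero => simp [fock]
        | succ d ih => exact Submodule.mem_sup_left ih
      simpa using this _
    | cons i w ih =>
      rw [List.map_cons, List.prod_cons, mul_assoc, List.length_cons]
      rcases lt_trichotomy i i.rev with hi | hi | hi
      · rw [← lowGen_eq]
        exact hF.x_mul_mem_fock le_rfl ih (low_of_lt hi) (by omega)
      · rw [← midGen_eq hi]
        exact hF.t_mul_fock hv le_rfl ih
      · rw [gen_eq_highGen_rev]
        exact hF.y_mul_mem_fock hv le_rfl ih (low_of_lt (by rwa [Fin.rev_rev]))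
  | zero => rw [zero_mul]; exact zero_mem _
  | add a b _ _ ha hb => rw [add_mul]; exact add_mem ha hb
  | smul c a _ ha => rw [smul_mul_assoc]; exact Submodule.smul_mem _ _ ha

theorem centerMuParity_eq_span (hq : q ≠ 0) (h2 : q ^ 2 ≠ 1) (h2' : q ^ 2 ≠ -1)
    (h4 : q ^ 4 ≠ -1) (hN : q ^ (2 * N) ≠ 1) (hc : c2 ≠ 0) (hN3 : 3 ≤ N)
    (μ : Fin (N / 2) → ℂˣ) {η : Fin 2} (hη : η = 0 ∨ Odd N) :
    Module.finrank ℂ (centerMuParity N q c2 μ η) = 1 ∧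
      centerMuParity N q c2 μ η = Submodule.span ℂ {zElem N hN3 q c2 μ η} := by
  have hF := isFermiSystem_gen (c2 := c2) hq h2 h2' h4 hN hc
  have : Nontrivial (Cl N q c2) := nontrivial_Cl hq h2 h2' h4 hN hc
  have hp : q ^ 2 ≠ 0 := pow_ne_zero 2 hq
  have hκ : ∀ j < N / 2, anticommConst N q c2 j ≠ 0 := fun j _ => anticommConst_ne_zero hq h2' hc j
  have hθ : (-q ^ 2) ^ (η : ℕ) ≠ 0 := pow_ne_zero _ (neg_ne_zero.mpr hp)
  have hv := hF.y_mul_vacuum le_rfl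
  have hv0 := hF.vacuum_ne_zero hp hκ
  set v := vacuum (highGen N q c2) (N / 2) with hvdef
  set w := midGen N q c2 ^ (η : ℕ) with hw
  have hwx : ∀ i < N / 2, w * lowGen N q c2 i = (-q ^ 2) ^ (η : ℕ) • (lowGen N q c2 i * w) := by
    intro i hi
    rcases Fin.exists_fin_two.mp ⟨η, rfl⟩ with h | h
    · simp [hw, h]
    · simpa [hw, h] using hF.t_mul_x i hi
  have hyw : ∀ i < N / 2, highGen N q c2 i * w = (-q ^ 2) ^ (η : ℕ) • (w * highGen N q c2 i) := by
    intro i hi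
    rcases Fin.exists_fin_two.mp ⟨η, rfl⟩ with h | h
    · simp [hw, h]
    · simpa [hw, h] using hF.y_mul_t i hi
  have hwt : w * midGen N q c2 = midGen N q c2 * w := (Commute.pow_left rfl _)
  have hwv : w * v ≠ 0 := by
    rcases Fin.exists_fin_two.mp ⟨η, rfl⟩ with h | h
    · simpa [hw, h] using hv0
    · have ht := hF.t_sq_apply hv
      have hodd : Odd N := hη.resolve_left (by rw [h]; decide)
      rw [if_neg (Nat.not_even_iff_odd.mpr hodd)] at ht
      intro h0
      have h0' : midGen N q c2 * v = 0 := by simpa [hw, h] using h0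
      rw [h0', mul_zero] at ht
      exact (smul_ne_zero hc hv0) ht.symm
  have hzv : zElem N hN3 q c2 μ η * v = w * v := by
    rw [zElem_eq_nestedSum hN3 μ hη]
    simpa using hF.nestedSum_mul_of_killed (μ := muNat μ) hwx hκ hv le_rfl
  have hzmem : zElem N hN3 q c2 μ η ∈ centerMuParity N q c2 μ η := by
    refine ⟨fun i => ?_, zElem_mem_parity hN3 μ η⟩
    rw [zElem_eq_nestedSum hN3 μ hη]
    -- At the last stage there are no lower annihilators, so the vector may be taken to be `1`.
    obtain ⟨h1, h3, h5⟩ := hF.nestedSum_mul_comm (μ := muNat μ) hwx hyw hwt hp hθ hκ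
      (fun j _ => muNat_ne_zero μ j) le_rfl (v := 1) (by simp)
    simp only [Nat.sub_self, mul_one] at h1 h3 h5
    rcases lt_trichotomy i i.rev with hi | hi | hi
    · rw [muExt_of_lt μ hi, ← lowGen_eq]
      exact h1 i (low_of_lt hi) (Nat.zero_le _)
    · rw [muExt_of_eq μ hi, ← midGen_eq hi, one_smul]
      exact h5
    · rw [muExt_of_gt μ hi, gen_eq_highGen_rev]
      exact h3 _ (low_of_lt (by rwa [Fin.rev_rev])) (Nat.zero_le _)
  have hz0 : zElem N hN3 q c2 μ η ≠ 0 := fun h0 => hwv (by rw [← hzv, h0, zero_mul])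
  have heq : centerMuParity N q c2 μ η = Submodule.span ℂ {zElem N hN3 q c2 μ η} := by
    refine le_antisymm (fun z hz => ?_) ((Submodule.span_singleton_le_iff_mem _ _).mpr hzmem)
    have hkill : ∀ k < N / 2, highGen N q c2 k * (z * v) = 0 := by
      intro k hk
      obtain ⟨i, rfl⟩ : ∃ i : Fin N, (i : ℕ) = k := ⟨⟨k, by omega⟩, rfl⟩
      -- Moving z past the annihilator leaves a nonzero multiple of y_k z v equal to z y_k v = 0.
      have h1 := hz.1 i.rev
      rw [← highGen_eq] at h1
      have h3 := congrArg (· * v) h1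
      simp only [mul_assoc, smul_mul_assoc] at h3
      rw [hv i hk, mul_zero] at h3
      exact (smul_eq_zero.mp h3.symm).resolve_left (Units.ne_zero _)
    have hmem := hF.mem_fock_zero hκ hv le_rfl (mul_vacuum_mem_fock hF hz.2) hkill
    rw [fock, Nat.mod_eq_of_lt η.2] at hmem
    obtain ⟨c, hcz⟩ := Submodule.mem_span_singleton.mp hmem
    have hd : z - c • zElem N hN3 q c2 μ η ∈ centerMu N q c2 μ :=
      sub_mem hz.1 (Submodule.smul_mem _ _ hzmem.1)
    have hdv : (z - c • zElem N hN3 q c2 μ η) * v = 0 := by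
      rw [sub_mul, smul_mul_assoc, hzv, ← hcz, sub_self]
    have hd0 : z - c • zElem N hN3 q c2 μ η = 0 := by
      refine hF.eq_zero_of_mul_vacuum hp hκ fun a => ?_
      obtain ⟨b, hb⟩ := exists_mul_comm_of_mem_centerMu hd a
      rw [← mul_assoc, hb, mul_assoc, hdv, mul_zero]
    exact Submodule.mem_span_singleton.mpr ⟨c, (sub_eq_zero.mp hd0).symm⟩
  exact ⟨by rw [heq]; exact finrank_span_singleton hz0, heq⟩

end

end FRTClifford

end

theorem mainTheorem8 (q : ℂ) (hq : q ≠ 0) (hroot : ∀ m : ℕ, 0 < m → q ^ m ≠ 1)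
    (c2 : ℝ) (hc : c2 ≠ 0) (N : ℕ) (hN : 3 ≤ N) (μ : Fin (N / 2) → ℂˣ) :
    (Module.finrank ℂ (FRTClifford.centerMuParity N q (c2 : ℂ) μ 0) = 1 ∧
      FRTClifford.centerMuParity N q (c2 : ℂ) μ 0
        = Submodule.span ℂ {FRTClifford.zElem N hN q (c2 : ℂ) μ 0}) ∧
    (Odd N →
      Module.finrank ℂ (FRTClifford.centerMuParity N q (c2 : ℂ) μ 1) = 1 ∧
      FRTClifford.centerMuParity N q (c2 : ℂ) μ 1
        = Submodule.span ℂ {FRTClifford.zElem N hN q (c2 : ℂ) μ 1}) := by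
  -- Of the root-of-unity hypothesis only the exponents 2, 4, 8 and `2 * N` are used; 4 and 8
  -- exclude q² = -1 and q⁴ = -1.
  have h2 : q ^ 2 ≠ 1 := hroot 2 (by norm_num)
  have h2' : q ^ 2 ≠ -1 := fun h => hroot 4 (by norm_num) (by linear_combination (q ^ 2 - 1) * h)
  have h4 : q ^ 4 ≠ -1 := fun h => hroot 8 (by norm_num) (by linear_combination (q ^ 4 - 1) * h)
  have hN' : q ^ (2 * N) ≠ 1 := hroot _ (by omega)
  have hc' : (c2 : ℂ) ≠ 0 := Complex.ofReal_ne_zero.mpr hc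
  exact ⟨FRTClifford.centerMuParity_eq_span hq h2 h2' h4 hN' hc' hN μ (Or.inl rfl),
    fun hodd => FRTClifford.centerMuParity_eq_span hq h2 h2' h4 hN' hc' hN μ (Or.inr hodd)⟩
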